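/- **Theorem 7.3 (unital tail algebra case).** Let $\mathcal A$ be a von Neumann algebra on a Hilbert space, with unit $1$, and let $\phi$ be a normal state on $\mathcal A$ that is non-degenerated, i.e. for $x\in\mathcal A$, if $\phi(axb)=0$ for all $a,b\in\mathcal A$ then $x=0$. Let $(x_i)_{i\in\mathbb N}$ be a sequence of selfadjoint elements of $\mathcal A$ such that $\mathcal A$ is the WOT closure of the unital algebra generated by $(x_i)_{i\in\mathbb N}$, and suppose that $1$ is not contained in the WOT closure of the non-unital algebra generated by $(x_i)_{i\in\mathbb N}$. *Tail algebras.* Let $vN\{x_k\mid k\ge n\}$ and $W^*\{x_k\mid k\ge n\}$ be the WOT closures of the unital and of the non-unital algebra generated by $\{x_k\mid k\ge n\}$, and put $\mathcal A_{tail}=\bigcap_n vN\{x_k\mid k\ge n\}$ and $\mathcal T=\bigcap_n W^*\{x_k\mid k\ge n\}$. *Invariance.* For $n\in\mathbb N$ let $B_s(n)$ be the universal unital C*-algebra generated by projections $u_{ij}$ $(1\le i,j\le n)$ and a projection $\mathbf P$ such that $u_{ik}u_{il}=0=u_{ki}u_{li}$ for $k\ne l$ and $\sum_{k=1}^n u_{ki}\mathbf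 P=\mathbf P$ for all $i$; let $\mathcal B_s(n)=\mathbf P B_s(n)\mathbf P$, with unit $\mathbf P$. The linear coaction of $\mathcal B_s(n)$ is the linear map $\mathcal L_n:\mathbb C\langle X_1,\dots,X_n\rangle\to\mathbb C\langle X_1,\dots,X_n\rangle\otimes\mathcal B_s(n)$ with $$\mathcal L_n(X_{i_1}\cdots X_{i_k})=\sum_{j_1,\dots,j_k=1}^n X_{j_1}\cdots X_{j_k}\otimes\mathbf P u_{j_1i_1}\cdots u_{j_ki_k}\mathbf P\qquad(k\ge 0).$$ Let $\mu_{x_1,\dots,x_n}(p)=\phi(p(x_1,\dots,x_n))$ be the joint distribution of the first $n$ variables. *Conditional boolean independence.* For a unital subalgebra $\mathcal B\subseteq\mathcal A$, a linear map $E:\mathcal A\to\mathcal B$ is a conditional expectation onto $\mathcal B$ if it is surjective and $E[b_1ab_2]=b_1E[a]b_2$ for all $b_1,b_2\in\mathcal B$, $a\in\mathcal A$. Let $\mathcal B\langle X\rangle$ be the algebra freely generated by $\mathcal B$ and $X$, and $\mathcal B\langle X\rangle_0$ the span of the monomials $b_0Xb_1X\cdots Xb_m$ with $m\ge1$ and $b_k\in\mathcal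 B\cup\mathbb C1_X$, where $1_X$ is the unit of $\mathbb C\langle X\rangle$. The $x_i$ are identically distributed with respect to $E$ if $E[p(x_i)]=E[p(x_j)]$ for all $i,j$ and all $p\in\mathcal B\langle X\rangle$; they are boolean independent with respect to $E$ if $$E[p_1(x_{i_1})\cdots p_m(x_{i_m})]=E[p_1(x_{i_1})]\cdots E[p_m(x_{i_m})]$$ for all $m\ge1$, all $i_1\neq i_2\neq\cdots\neq i_m$ (consecutive indices differ) and all $p_1,\dots,p_m\in\mathcal B\langle X\rangle_0$. Then $\mathcal A_{tail}=\mathcal T+\mathbb C1$, and the following are equivalent: a) The joint distribution of $(x_i)_{i\in\mathbb N}$ satisfies the invariance condition associated with the linear coactions of the $\mathcal B_s(n)$: for all $n$ and all $p\in\mathbb C\langle X_1,\dots,X_n\rangle$, $$(\mu_{x_1,\dots,x_n}\otimes\mathrm{id}_{\mathcal B_s(n)})(\mathcal L_n p)=\mu_{x_1,\dots,x_n}(p)\,\mathbf P.$$ b) There is a normal conditional expectation $E$ of $\mathcal A$ onto $\mathcal A_{tail}$ with $\phi\circ E=\phi$ such that the sequence $(x_i)_{i\in\mathbb N}$ is identically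 distributed and boolean independent with respect to $E$. -/

import Mathlib

noncomputable section

namespace BooleanDeFinetti

open scoped ENNReal TensorProduct ComplexOrder

/-! ### The quantum semigroups `B_s(n)` and their corners `P B_s(n) P` -/

/-- The defining relations of `B_s(n)` for elements `u i j`, `P` of a unital `*`-algebra. -/
structure BoolRel (n : ℕ) {D : Type*} [Ring D] [StarRing D]
    (u : Fin n → Fin n → D) (P : D) : Prop where
  proj_u : ∀ i j, IsStarProjection (u i j)
  proj_P : IsStarProjection P
  row : ∀ i k l, k ≠ l → u i k * u i l = 0
  col : ∀ i k l, k ≠ l → u k i * u l i = 0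
  inv : ∀ i, ∑ k, u k i * P = P

/-- A nonzero unital C*-algebra with a choice of elements satisfying the relations of `B_s(n)`.
(A finitely generated C*-algebra has at most continuum many elements, so `Type` is large enough to
contain a copy of each C*-algebra generated by such elements.) -/
structure BoolRep (n : ℕ) : Type 1 where
  D : Type
  [cstar : CStarAlgebra D]
  [nontriv : Nontrivial D]
  u : Fin n → Fin n → D
  P : D
  rel : BoolRel n u P

attribute [instance] BoolRep.cstar BoolRep.nontriv

/-- The `ℓ^∞`-product of all C*-algebras carrying elements with the relations of `B_s(n)`. -/
abbrev BoolProd (n : ℕ) : Type 1 := lp (fun r : BoolRep n => r.D) ∞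

instance (n : ℕ) : CStarAlgebra (BoolProd n) where
  toNormedRing := lp.inftyNormedRing
  toStarRing := lp.inftyStarRing
  toCompleteSpace := inferInstance
  toCStarRing := lp.inftyCStarRing
  toNormedAlgebra := lp.inftyNormedAlgebra
  toStarModule := inferInstance

theorem norm_le_one_of_isStarProjection {D : Type*} [CStarAlgebra D] {p : D}
    (hp : IsStarProjection p) : ‖p‖ ≤ 1 := by
  have h : ‖p‖ = ‖p‖ * ‖p‖ := by
    conv_lhs => rw [← hp.isIdempotentElem.eq]
    conv_lhs => rw [← hp.isSelfAdjoint.star_eq]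
    conv_rhs => rw [← CStarRing.norm_star_mul_self]
    rw [hp.isSelfAdjoint.star_eq]
  nlinarith [norm_nonneg p]

/-- The family of all `u i j`, as an element of the product. -/
def prodU (n : ℕ) (i j : Fin n) : BoolProd n :=
  ⟨fun r => r.u i j, memℓp_infty ⟨1, by
    rintro _ ⟨r, rfl⟩; exact norm_le_one_of_isStarProjection (r.rel.proj_u i j)⟩⟩

/-- The family of all `P`, as an element of the product. -/
def prodP (n : ℕ) : BoolProd n :=
  ⟨fun r => r.P, memℓp_infty ⟨1, by
    rintro _ ⟨r, rfl⟩; exact norm_le_one_of_isStarProjection r.rel.proj_P⟩⟩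

/-- The set of generators. -/
def gens (n : ℕ) : Set (BoolProd n) :=
  insert (prodP n) (Set.range fun q : Fin n × Fin n => prodU n q.1 q.2)

/-- The closed unital `*`-subalgebra of the product generated by the universal family. -/
def BsSub (n : ℕ) : StarSubalgebra ℂ (BoolProd n) :=
  (StarAlgebra.adjoin ℂ (gens n)).topologicalClosure

instance (n : ℕ) : IsClosed (BsSub n : Set (BoolProd n)) :=
  StarSubalgebra.isClosed_topologicalClosure _

/-- `B_s(n)`: the universal unital C*-algebra generated by projections `u i j` and `P` with the
above relations, realized as the closed unital `*`-subalgebra generated by the universal family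
in the product of all its representations. -/
def Bs (n : ℕ) : Type 1 := BsSub n

instance (n : ℕ) : CStarAlgebra (Bs n) := StarSubalgebra.cstarAlgebra (BsSub n)

/-- The inclusion of `B_s(n)` into the product. -/
def Bs.incl (n : ℕ) : Bs n →⋆ₐ[ℂ] BoolProd n := (BsSub n).subtype

theorem Bs.incl_injective (n : ℕ) : Function.Injective (Bs.incl n) := Subtype.val_injective

/-- The generators `u i j` of `B_s(n)`. -/
def genU (n : ℕ) (i j : Fin n) : Bs n :=
  ⟨prodU n i j, StarSubalgebra.le_topologicalClosure _
    (StarAlgebra.subset_adjoin ℂ _ (Set.mem_insert_of_mem _ ⟨(i, j), rfl⟩))⟩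

/-- The invariant projection `P` of `B_s(n)`. -/
def genP (n : ℕ) : Bs n :=
  ⟨prodP n, StarSubalgebra.le_topologicalClosure _
    (StarAlgebra.subset_adjoin ℂ _ (Set.mem_insert _ _))⟩

theorem prod_rel (n : ℕ) : BoolRel n (prodU n) (prodP n) where
  proj_u i j := by
    constructor
    · exact lp.ext (funext fun r => (r.rel.proj_u i j).isIdempotentElem)
    · exact lp.ext (funext fun r => (r.rel.proj_u i j).isSelfAdjoint)
  proj_P := by
    constructor
    · exact lp.ext (funext fun r => r.rel.proj_P.isIdempotentElem)
    · exact lp.ext (funext fun r => r.rel.proj_P.isSelfAdjoint)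
  row i k l h := lp.ext (funext fun r => r.rel.row i k l h)
  col i k l h := lp.ext (funext fun r => r.rel.col i k l h)
  inv i := lp.ext (funext fun r => by
    have h := r.rel.inv i
    rw [lp.coeFn_sum, Finset.sum_apply]
    exact h)

/-- The generators of `B_s(n)` satisfy the defining relations. -/
theorem gen_rel (n : ℕ) : BoolRel n (genU n) (genP n) where
  proj_u i j := by
    constructor
    · exact Bs.incl_injective n ((prod_rel n).proj_u i j).isIdempotentElem
    · exact Bs.incl_injective n ((prod_rel n).proj_u i j).isSelfAdjoint
  proj_P := by
    constructor
    · exact Bs.incl_injective n (prod_rel n).proj_P.isIdempotentElem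
    · exact Bs.incl_injective n (prod_rel n).proj_P.isSelfAdjoint
  row i k l h := Bs.incl_injective n ((prod_rel n).row i k l h)
  col i k l h := Bs.incl_injective n ((prod_rel n).col i k l h)
  inv i := Bs.incl_injective n (by
    rw [map_sum]
    exact (prod_rel n).inv i)

/-- The unital `*`-homomorphism from `B_s(n)` onto the algebra generated by a given family. -/
def Bs.lift {n : ℕ} (r : BoolRep n) : Bs n →⋆ₐ[ℂ] r.D where
  toFun b := b.1 r
  map_one' := rfl
  map_mul' _ _ := rfl
  map_zero' := rfl
  map_add' _ _ := rfl
  commutes' _ := rfl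
  map_star' _ := rfl

/-- The universal property of `B_s(n)`. -/
theorem Bs.existsUnique_lift {n : ℕ} (r : BoolRep n) :
    ∃! f : Bs n →⋆ₐ[ℂ] r.D, (∀ i j, f (genU n i j) = r.u i j) ∧ f (genP n) = r.P := by
  refine ⟨Bs.lift r, ⟨fun _ _ => rfl, rfl⟩, ?_⟩
  rintro f ⟨hu, hP⟩
  have h1 : Continuous f :=
    AddMonoidHomClass.continuous_of_bound f 1 fun a => by
      simpa using! NonUnitalStarAlgHom.norm_apply_le f a
  have h2 : Continuous (Bs.lift r) :=
    AddMonoidHomClass.continuous_of_bound (Bs.lift r) 1 fun a => by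
      simpa using! NonUnitalStarAlgHom.norm_apply_le (Bs.lift r) a
  refine StarAlgHom.ext_topologicalClosure (S := StarAlgebra.adjoin ℂ (gens n))
    (φ := f) (ψ := Bs.lift r) h1 h2 ?_
  refine StarAlgHom.ext_adjoin ?_
  rintro ⟨a, ha⟩ hag
  rcases hag with rfl | ⟨⟨i, j⟩, rfl⟩
  · exact hP
  · exact hu i j

/-- `𝓑_s(n) = P B_s(n) P`, with unit `P`. -/
def BsCorner (n : ℕ) : NonUnitalStarSubalgebra ℂ (Bs n) where
  carrier := {b | ∃ a, b = genP n * a * genP n}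
  zero_mem' := ⟨0, by simp⟩
  add_mem' := by
    rintro _ _ ⟨a, rfl⟩ ⟨b, rfl⟩
    exact ⟨a + b, by rw [mul_add, add_mul]⟩
  mul_mem' := by
    rintro _ _ ⟨a, rfl⟩ ⟨b, rfl⟩
    exact ⟨a * genP n * genP n * b, by simp only [mul_assoc]⟩
  smul_mem' := by
    rintro c _ ⟨a, rfl⟩
    exact ⟨c • a, by rw [mul_smul_comm, smul_mul_assoc]⟩
  star_mem' := by
    rintro _ ⟨a, rfl⟩
    refine ⟨star a, ?_⟩
    rw [star_mul, star_mul, (gen_rel n).proj_P.isSelfAdjoint.star_eq, mul_assoc]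

/-- The compression `a ↦ P a P` of `B_s(n)` to `𝓑_s(n)`. -/
def compress (n : ℕ) (a : Bs n) : BsCorner n := ⟨genP n * a * genP n, a, rfl⟩

/-! ### Joint distributions and the linear coaction -/

/-- The joint distribution of finitely many elements with respect to a linear functional. -/
def jointDist {𝒜 : Type*} [Ring 𝒜] [Algebra ℂ 𝒜] (φ : 𝒜 →ₗ[ℂ] ℂ) {n : ℕ} (x : Fin n → 𝒜) :
    FreeAlgebra ℂ (Fin n) →ₗ[ℂ] ℂ :=
  φ ∘ₗ (FreeAlgebra.lift ℂ x).toLinearMap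

/-- The linear coaction of `𝓑_s(n)` on noncommutative polynomials, given on the basis of
monomials `X_{i_1} ⋯ X_{i_k}` by
`∑_{j_1, …, j_k} X_{j_1} ⋯ X_{j_k} ⊗ P u_{j_1 i_1} ⋯ u_{j_k i_k} P`. -/
def linearCoaction (n : ℕ) :
    FreeAlgebra ℂ (Fin n) →ₗ[ℂ] FreeAlgebra ℂ (Fin n) ⊗[ℂ] BsCorner n :=
  (FreeAlgebra.basisFreeMonoid ℂ (Fin n)).constr ℂ fun w =>
    ∑ j : Fin w.toList.length → Fin n,
      (List.ofFn fun q => FreeAlgebra.ι ℂ (j q)).prod ⊗ₜ[ℂ]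
        compress n (List.ofFn fun q => genU n (j q) (w.toList.get q)).prod

/-- A functional `μ` is invariant under the linear coaction: `(μ ⊗ id)(L p) = μ(p) P`. -/
def IsLinearlyInvariant {n : ℕ} (μ : FreeAlgebra ℂ (Fin n) →ₗ[ℂ] ℂ) : Prop :=
  ∀ p : FreeAlgebra ℂ (Fin n),
    TensorProduct.lid ℂ (BsCorner n) (μ.rTensor (BsCorner n) (linearCoaction n p)) =
      μ p • compress n 1

/-- The joint distribution of an infinite sequence satisfies the invariance condition associated
with the linear coactions of the `𝓑_s(n)`, for all `n`. -/
def SatisfiesBooleanInvariance {𝒜 : Type*} [Ring 𝒜] [Algebra ℂ 𝒜] (φ : 𝒜 →ₗ[ℂ] ℂ)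
    (x : ℕ → 𝒜) : Prop :=
  ∀ n : ℕ, IsLinearlyInvariant (jointDist φ fun i : Fin n => x i)

/-! ### Operator valued probability -/

section OperatorValued

variable {𝒜 : Type*} [Ring 𝒜] [Algebra ℂ 𝒜]

/-- The relations saying that the letters `some b` form a copy of the algebra `ℬ`. -/
inductive BPolyRel (ℬ : Subalgebra ℂ 𝒜) :
    FreeAlgebra ℂ (Option ℬ) → FreeAlgebra ℂ (Option ℬ) → Prop
  | add (b c : ℬ) : BPolyRel ℬ (FreeAlgebra.ι ℂ (some (b + c)))
      (FreeAlgebra.ι ℂ (some b) + FreeAlgebra.ι ℂ (some c))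
  | smul (r : ℂ) (b : ℬ) : BPolyRel ℬ (FreeAlgebra.ι ℂ (some (r • b)))
      (r • FreeAlgebra.ι ℂ (some b))
  | mul (b c : ℬ) : BPolyRel ℬ (FreeAlgebra.ι ℂ (some (b * c)))
      (FreeAlgebra.ι ℂ (some b) * FreeAlgebra.ι ℂ (some c))

/-- `ℬ⟨X⟩`: the algebra freely generated by `ℬ` and the indeterminate `X` (the letter `none`).
Its unit `1_X` is adjoined, i.e. not identified with the unit of `ℬ`. -/
abbrev BPoly (ℬ : Subalgebra ℂ 𝒜) : Type _ := RingQuot (BPolyRel ℬ)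

/-- The indeterminate `X` of `ℬ⟨X⟩`. -/
def BPoly.X (ℬ : Subalgebra ℂ 𝒜) : BPoly ℬ :=
  RingQuot.mkAlgHom ℂ (BPolyRel ℬ) (FreeAlgebra.ι ℂ none)

/-- `ℬ⟨X⟩₀`: the polynomials without constant term, i.e. the span of the monomials
`b₀ X b₁ X ⋯ X bₙ` with `n ≥ 1`, which is the span of all `f X g`. -/
def BPoly.noConst (ℬ : Subalgebra ℂ 𝒜) : Submodule ℂ (BPoly ℬ) :=
  Submodule.span ℂ {p | ∃ f g : BPoly ℬ, p = f * BPoly.X ℬ * g}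

/-- Evaluation `p ↦ p(x)` of `ℬ`-polynomials. -/
def BPoly.eval (ℬ : Subalgebra ℂ 𝒜) (x : 𝒜) : BPoly ℬ →ₐ[ℂ] 𝒜 :=
  RingQuot.liftAlgHom ℂ ⟨FreeAlgebra.lift ℂ (fun o : Option ℬ => o.elim x fun b => (b : 𝒜)), by
    intro p q h
    induction h <;> simp⟩

/-- `E : 𝒜 → ℬ` is a conditional expectation: a `ℬ`-`ℬ` bimodule map which is onto. -/
structure IsConditionalExpectation {ℬ : Subalgebra ℂ 𝒜} (E : 𝒜 →ₗ[ℂ] ℬ) : Prop where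
  bimodule : ∀ (b₁ b₂ : ℬ) (a : 𝒜), E ((b₁ : 𝒜) * a * (b₂ : 𝒜)) = b₁ * E a * b₂
  onto : Function.Surjective E

/-- The `x i` are identically distributed with respect to `E`. -/
def IdentDistribOver {ℬ : Subalgebra ℂ 𝒜} (E : 𝒜 →ₗ[ℂ] ℬ) {I : Type*} (x : I → 𝒜) : Prop :=
  ∀ (i j : I) (p : BPoly ℬ), E (BPoly.eval ℬ (x i) p) = E (BPoly.eval ℬ (x j) p)

/-- The `x i` are boolean independent with respect to `E`:
`E[p₁(x_{i₁}) ⋯ p_m(x_{i_m})] = E[p₁(x_{i₁})] ⋯ E[p_m(x_{i_m})]` for `m ≥ 1`,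
`i₁ ≠ i₂ ≠ ⋯ ≠ i_m` (consecutive indices differ) and `p₁, …, p_m ∈ ℬ⟨X⟩₀`. -/
def BooleanIndepOver {ℬ : Subalgebra ℂ 𝒜} (E : 𝒜 →ₗ[ℂ] ℬ) {I : Type*} (x : I → 𝒜) : Prop :=
  ∀ l : List (I × BPoly ℬ), l ≠ [] → l.IsChain (fun q r => q.1 ≠ r.1) →
    (∀ q ∈ l, q.2 ∈ BPoly.noConst ℬ) →
    E (l.map fun q => BPoly.eval ℬ (x q.1) q.2).prod =
      (l.map fun q => E (BPoly.eval ℬ (x q.1) q.2)).prod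

end OperatorValued

/-! ### W*-probability spaces and tail algebras -/

section VonNeumann

variable {H : Type*} [NormedAddCommGroup H] [InnerProductSpace ℂ H] [CompleteSpace H]

/-- The inclusion of a von Neumann algebra into the bounded operators with the weak operator
topology. -/
def toWOT (A : VonNeumannAlgebra H) : A.toStarSubalgebra →ₐ[ℂ] (H →WOT[ℂ] H) :=
  ((ContinuousLinearMapWOT.algEquiv (𝕜₁ := ℂ) (E := H) ℂ).symm : (H →L[ℂ] H) →ₐ[ℂ] (H →WOT[ℂ] H)).comp
    A.toStarSubalgebra.toSubalgebra.val

/-- The weak operator topology on a von Neumann algebra. -/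
abbrev wotTopology (A : VonNeumannAlgebra H) : TopologicalSpace A.toStarSubalgebra :=
  TopologicalSpace.induced (toWOT A) inferInstance

/-- Normality (ultraweak continuity) of a linear map defined on a von Neumann algebra `A`: it is
continuous for the weak operator topology of `A` on norm bounded sets (on which the weak operator
topology and the ultraweak topology coincide). The target is `ℂ`, or operators with the weak
operator topology. -/
def IsNormalMap {A : VonNeumannAlgebra H} {Y : Type*} [TopologicalSpace Y]
    (f : A.toStarSubalgebra → Y) : Prop :=
  ∀ r : ℝ, @ContinuousOn _ _ (wotTopology A) _ f {a | ‖a‖ ≤ r}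

/-- Normal states. -/
structure IsNormalState {A : VonNeumannAlgebra H} (φ : A.toStarSubalgebra →ₗ[ℂ] ℂ) : Prop where
  map_one : φ 1 = 1
  nonneg : ∀ a, 0 ≤ φ (a * star a)
  normal : IsNormalMap φ

/-- Non-degenerated functionals: `x = 0` whenever `φ(axb) = 0` for all `a, b`. -/
def IsNondegenerated {A : VonNeumannAlgebra H} (φ : A.toStarSubalgebra →ₗ[ℂ] ℂ) : Prop :=
  ∀ x, (∀ a b, φ (a * x * b) = 0) → x = 0

/-- The weak operator closure of the unital algebra generated by `S`; for a set `S` of selfadjoint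
elements, this is the von Neumann algebra generated by `S`. -/
def vN {A : VonNeumannAlgebra H} (S : Set A.toStarSubalgebra) : Subalgebra ℂ A.toStarSubalgebra :=
  ((Algebra.adjoin ℂ S).map (toWOT A)).topologicalClosure.comap (toWOT A)

/-- The weak operator closure of the non-unital algebra generated by `S`. -/
def wStar {A : VonNeumannAlgebra H} (S : Set A.toStarSubalgebra) :
    NonUnitalSubalgebra ℂ A.toStarSubalgebra :=
  ((NonUnitalAlgebra.adjoin ℂ S).map (toWOT A)).topologicalClosure.comap (toWOT A)

/-- The unital tail algebra `⋂ₙ vN{x_k | k ≥ n}`. -/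
def unitalTail {A : VonNeumannAlgebra H} (x : ℕ → A.toStarSubalgebra) :
    Subalgebra ℂ A.toStarSubalgebra :=
  ⨅ n : ℕ, vN (x '' Set.Ici n)

/-- The non-unital tail algebra `⋂ₙ W*{x_k | k ≥ n}`. -/
def nonunitalTail {A : VonNeumannAlgebra H} (x : ℕ → A.toStarSubalgebra) :
    NonUnitalSubalgebra ℂ A.toStarSubalgebra :=
  ⨅ n : ℕ, wStar (x '' Set.Ici n)

end VonNeumann

end BooleanDeFinetti

end

open BooleanDeFinetti

noncomputable section

namespace BooleanDeFinetti

open scoped ENNReal TensorProduct ComplexOrder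

/-! ### Words with the same runs -/

/-! Both conditions are equivalent to a third, purely combinatorial one: the moment `φ (x_{i₁} ⋯
x_{iₖ})` depends only on the positions at which consecutive indices agree (`RunEq`).

From invariance to runs, `B_s(n)` is represented by rank one projections whose spanning vectors have
inner products depending only on whether the row indices agree and whether the column indices agree.
In the vector state at the range of `P`, the coefficient of each monomial in the coaction then sees
only the runs of the original word. Conversely, the row and column relations kill every summand with
a different run pattern, and the surviving products add up to `P`
(`satisfiesBooleanInvariance_of_runEq`). Conditional boolean independence together with identical
distribution gives run invariance by grouping each run into a power (`map_prod_eq_of_runEq`).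

The substance is the passage from runs to an expectation. In the GNS space let `Q` be the projection
onto the intersection of the closed spans of words with letters at least `N`. Words with shifted
letters converge weakly to their image under `Q`, which gives `x_i Q x_j = x_i x_j` for `i ≠ j`
(`mul_tailProj_mul`) and makes `Q w Q` invariant under injective relabelling of a word `w`. A weak
limit of shifts of `w` lies in the non-unital tail algebra and is represented by `Q w Q`; bounded
approximation, a form of Kaplansky density, extends this to the whole weak closure.

Since `1` is outside the non-unital closure, that closure is the kernel of a character `χ`, and `E`
is determined by `π (E a) = Q π(a) Q + χ(a) (1 - Q)`. Nondegeneracy makes `π` faithful, hence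
isometric. Boolean independence is then the insertion of `Q` between factors with different indices.
-/

/-- Two words have the same length, and consecutive letters agree in one if and only if they agree
in the other. -/
inductive RunEq {α β : Type*} : List α → List β → Prop
  | nil : RunEq [] []
  | single (a : α) (b : β) : RunEq [a] [b]
  | cons {a a' : α} {b b' : β} {w : List α} {w' : List β} (h : a = a' ↔ b = b')
      (hw : RunEq (a' :: w) (b' :: w')) : RunEq (a :: a' :: w) (b :: b' :: w')

namespace RunEq

variable {α β γ δ : Type*}

theorem map {f : α → γ} {g : β → δ} (hf : f.Injective) (hg : g.Injective)
    {w : List α} {w' : List β} (h : RunEq w w') : RunEq (w.map f) (w'.map g) := by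
  induction h with
  | nil => exact .nil
  | single a b => exact .single _ _
  | cons h _ ih => exact .cons (by rw [hf.eq_iff, hg.eq_iff, h]) ih

theorem of_map {f : α → γ} {g : β → δ} (hf : f.Injective) (hg : g.Injective)
    {w : List α} {w' : List β} (h : RunEq (w.map f) (w'.map g)) : RunEq w w' := by
  generalize hu : w.map f = u at h
  generalize hv : w'.map g = v at h
  induction h generalizing w w' with
  | nil =>
    rw [List.map_eq_nil_iff] at hu hv
    subst hu hv
    exact .nil
  | single a b =>
    obtain ⟨a', rfl, -⟩ := List.map_eq_singleton_iff.1 hu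
    obtain ⟨b', rfl, -⟩ := List.map_eq_singleton_iff.1 hv
    exact .single _ _
  | cons h _ ih =>
    obtain ⟨a, w, rfl, rfl, hu'⟩ := List.map_eq_cons_iff.1 hu
    obtain ⟨b, w', rfl, rfl, hv'⟩ := List.map_eq_cons_iff.1 hv
    have hr := ih hu' hv'
    obtain ⟨a', w, rfl, rfl, -⟩ := List.map_eq_cons_iff.1 hu'
    obtain ⟨b', w', rfl, rfl, -⟩ := List.map_eq_cons_iff.1 hv'
    exact .cons (by rwa [hf.eq_iff, hg.eq_iff] at h) hr

theorem refl (w : List α) : RunEq w w := by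
  induction w with
  | nil => exact .nil
  | cons a w ih =>
    cases w with
    | nil => exact .single _ _
    | cons b w => exact .cons Iff.rfl ih

theorem map_right {f : α → β} (hf : f.Injective) (w : List α) : RunEq w (w.map f) := by
  simpa using (refl w).map Function.injective_id hf

theorem length_eq {w : List α} {w' : List β} (h : RunEq w w') : w.length = w'.length := by
  induction h with
  | nil => rfl
  | single => rfl
  | cons _ _ ih => simpa using ih

theorem append {u w : List α} {u' w' : List β} (hu : RunEq u u') (hw : RunEq w w')
    (h : ∀ a ∈ u.getLast?, ∀ b ∈ w.head?, ∀ a' ∈ u'.getLast?, ∀ b' ∈ w'.head?,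
      (a = b ↔ a' = b')) : RunEq (u ++ w) (u' ++ w') := by
  induction hu with
  | nil => exact hw
  | single a b =>
    cases hw with
    | nil => exact .single _ _
    | single c d => exact .cons (by simpa using h) (.single _ _)
    | cons h1 h2 => exact .cons (by simpa using h) (.cons h1 h2)
  | cons h1 h2 ih =>
    refine .cons h1 (ih ?_)
    simpa [List.getLast?_cons_cons] using h

end RunEq

/-! ### A representation of `B_s(n)` -/

section Representation

variable {n : ℕ}

/-- The vectors spanning the ranges of the projections in a representation of `B_s(n)`. -/
def repVec (n : ℕ) (k i : Fin n) : EuclideanSpace ℂ (Fin n × Fin n) :=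
  -- A constant plus a tensor of two centred basis vectors. The scale `1/√(n-1)` makes the squared
  -- norm `1/n`, and makes two vectors orthogonal when exactly one of their two indices agrees.
  WithLp.toLp 2 fun q => (1 / n ^ 2 : ℂ) + ((Real.sqrt (n - 1))⁻¹ : ℝ) *
    (((if k = q.1 then 1 else 0) - 1 / n) * ((if i = q.2 then 1 else 0) - 1 / n))

/-- The common column sum of the vectors `repVec n k i`. -/
def repSum (n : ℕ) : EuclideanSpace ℂ (Fin n × Fin n) :=
  WithLp.toLp 2 fun _ => (1 / n : ℂ)

/-- Centred basis vectors sum to zero, so only the constant part survives. Independence of `i` is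
what the relation `∑ u_{ki} P = P` requires. -/
theorem sum_repVec (hn : 2 ≤ n) (i : Fin n) : ∑ k, repVec n k i = repSum n := by
  have hn0 : (n : ℂ) ≠ 0 := by exact_mod_cast (by omega : n ≠ 0)
  ext q
  simp only [repVec, repSum, WithLp.ofLp_sum, Finset.sum_apply, Finset.sum_add_distrib,
    ← Finset.mul_sum, ← Finset.sum_mul, Finset.sum_sub_distrib]
  simp
  field_simp
  simp

/-- The constant and centred parts are orthogonal. The value sees the indices only through the truth
of `k = l` and of `i = j`, which is the source of run invariance; it vanishes when exactly one
holds, which gives the row and column relations. -/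
theorem inner_repVec (hn : 2 ≤ n) (k i l j : Fin n) :
    inner ℂ (repVec n k i) (repVec n l j) =
      (1 / n ^ 2 : ℂ) + (1 / (n - 1)) *
        (((if k = l then 1 else 0) - 1 / n) * ((if i = j then 1 else 0) - 1 / n)) := by
  have hn0 : (n : ℂ) ≠ 0 := by exact_mod_cast (by omega : n ≠ 0)
  have hn1 : (n : ℂ) - 1 ≠ 0 := by
    rw [sub_ne_zero]; exact_mod_cast (by omega : n ≠ 1)
  have hs : (((Real.sqrt (n - 1))⁻¹ : ℝ) : ℂ) * ((Real.sqrt (n - 1))⁻¹ : ℝ) = 1 / (n - 1) := by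
    rw [← Complex.ofReal_mul, ← mul_inv, Real.mul_self_sqrt]
    · push_cast; simp
    · rw [sub_nonneg]; exact_mod_cast (by omega : 1 ≤ n)
  set s : ℂ := (((Real.sqrt (n - 1))⁻¹ : ℝ) : ℂ) with hsdef
  have hstar : (starRingEnd ℂ) s = s := Complex.conj_ofReal _
  have h0 : ∀ k : Fin n, ∑ a : Fin n, ((if k = a then (1 : ℂ) else 0) - 1 / n) = 0 := by
    intro k; simp [Finset.sum_sub_distrib, hn0]
  -- Centring is a selfadjoint idempotent, so the Gram matrix of the centred basis vectors is the
  -- centring matrix itself.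
  have h1 : ∀ k l : Fin n, ∑ a : Fin n, ((if k = a then (1 : ℂ) else 0) - 1 / n) *
      ((if l = a then (1 : ℂ) else 0) - 1 / n) = (if k = l then 1 else 0) - 1 / n := by
    intro k l
    simp only [sub_mul, mul_sub, Finset.sum_sub_distrib, ← Finset.mul_sum, ← Finset.sum_mul]
    by_cases h : k = l <;> simp [h, hn0]
  have key : ∀ a b : Fin n,
      (starRingEnd ℂ) ((1 / n ^ 2 : ℂ) + s * (((if k = a then 1 else 0) - 1 / n) *
        ((if i = b then 1 else 0) - 1 / n))) = (1 / n ^ 2 : ℂ) + s *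
        (((if k = a then 1 else 0) - 1 / n) * ((if i = b then 1 else 0) - 1 / n)) := by
    intro a b
    split_ifs <;> simp [hstar]
  simp only [repVec, PiLp.inner_apply, RCLike.inner_apply, Fintype.sum_prod_type]
  simp only [← hsdef, key]
  have expand : ∀ a b : Fin n,
      ((1 / n ^ 2 : ℂ) + s * (((if l = a then 1 else 0) - 1 / n) *
        ((if j = b then 1 else 0) - 1 / n))) * ((1 / n ^ 2 : ℂ) + s *
        (((if k = a then 1 else 0) - 1 / n) * ((if i = b then 1 else 0) - 1 / n))) =
      1 / n ^ 2 * (1 / n ^ 2) +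
      (1 / n ^ 2 * s * ((if k = a then 1 else 0) - 1 / n)) * ((if i = b then 1 else 0) - 1 / n) +
      (1 / n ^ 2 * s * ((if l = a then 1 else 0) - 1 / n)) * ((if j = b then 1 else 0) - 1 / n) +
      (s * s * (((if k = a then 1 else 0) - 1 / n) * ((if l = a then 1 else 0) - 1 / n))) *
        (((if i = b then 1 else 0) - 1 / n) * ((if j = b then 1 else 0) - 1 / n)) := by
    intro a b; ring
  simp only [expand, Finset.sum_add_distrib, ← Finset.mul_sum, ← Finset.sum_mul, h0, h1, hs]
  simp
  field_simp

theorem inner_repSum_repVec (hn : 2 ≤ n) (k i : Fin n) :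
    inner ℂ (repVec n k i) (repSum n) = (1 / n : ℂ) := by
  have hn0 : (n : ℂ) ≠ 0 := by exact_mod_cast (by omega : n ≠ 0)
  have hn1 : (n : ℂ) - 1 ≠ 0 := by
    rw [sub_ne_zero]; exact_mod_cast (by omega : n ≠ 1)
  rw [← sum_repVec hn i, inner_sum]
  simp only [inner_repVec hn, Finset.sum_add_distrib, ← Finset.mul_sum, ← Finset.sum_mul,
    Finset.sum_sub_distrib]
  simp
  field_simp
  simp

theorem isStarProjection_smul_rankOne {V : Type*} [NormedAddCommGroup V] [InnerProductSpace ℂ V]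
    [CompleteSpace V] (v : V) (r : ℝ) (h : (r : ℂ) * inner ℂ v v = 1) :
    IsStarProjection ((r : ℂ) • InnerProductSpace.rankOne ℂ v v) := by
  constructor
  · ext y
    simp only [mul_apply_eq_comp, smul_apply,
      InnerProductSpace.rankOne_apply, inner_smul_right]
    simp only [smul_smul]
    congr 1
    linear_combination (r * inner ℂ v y) * h
  · rw [ContinuousLinearMap.isSelfAdjoint_iff_isSymmetric]
    intro y z
    simp

/-- Rank one projections satisfying the relations of `B_s(n)`. -/
def repU (n : ℕ) (k i : Fin n) :
    EuclideanSpace ℂ (Fin n × Fin n) →L[ℂ] EuclideanSpace ℂ (Fin n × Fin n) :=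
  ((n : ℝ) : ℂ) • InnerProductSpace.rankOne ℂ (repVec n k i) (repVec n k i)

/-- The representation of `B_s(n)` by rank one projections. -/
def boolRep (hn : 2 ≤ n) : BoolRep n where
  D := EuclideanSpace ℂ (Fin n × Fin n) →L[ℂ] EuclideanSpace ℂ (Fin n × Fin n)
  nontriv := by
    have : Nonempty (Fin n) := ⟨⟨0, by omega⟩⟩
    infer_instance
  u := repU n
  P := ((1 : ℝ) : ℂ) • InnerProductSpace.rankOne ℂ (repSum n) (repSum n)
  rel := by
    have hn0 : (n : ℂ) ≠ 0 := by exact_mod_cast (by omega : n ≠ 0)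
    have hn1 : (n : ℂ) - 1 ≠ 0 := by
      rw [sub_ne_zero]; exact_mod_cast (by omega : n ≠ 1)
    constructor
    · intro k i
      apply isStarProjection_smul_rankOne
      rw [inner_repVec hn]
      simp
      field_simp
      ring
    · apply isStarProjection_smul_rankOne
      have i0 : Fin n := ⟨0, by omega⟩
      conv_lhs => rw [← sum_repVec hn i0, sum_inner, sum_repVec hn i0]
      simp [inner_repSum_repVec hn, hn0]
    · intro i k l hkl
      have h0 : inner ℂ (repVec n i k) (repVec n i l) = 0 := by
        rw [inner_repVec hn]
        simp [hkl]
        field_simp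
        ring
      ext1 y
      simp [repU, h0]
    · intro i k l hkl
      have h0 : inner ℂ (repVec n k i) (repVec n l i) = 0 := by
        rw [inner_repVec hn]
        simp [hkl]
        field_simp
        ring
      ext1 y
      simp [repU, h0]
    · intro i
      rw [← Finset.sum_mul]
      ext1 y
      simp only [mul_apply_eq_comp, smul_apply,
        repU, InnerProductSpace.rankOne_apply, inner_smul_right, sum_apply,
        inner_repSum_repVec hn, smul_smul]
      rw [← Finset.smul_sum, sum_repVec hn]
      congr 1
      push_cast
      field_simp

/-- The representation of `B_s(n)` on a Euclidean space. -/
def boolLift (hn : 2 ≤ n) : Bs n →⋆ₐ[ℂ]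
    (EuclideanSpace ℂ (Fin n × Fin n) →L[ℂ] EuclideanSpace ℂ (Fin n × Fin n)) :=
  Bs.lift (boolRep hn)

theorem boolLift_genU (hn : 2 ≤ n) (k i : Fin n) : boolLift hn (genU n k i) = repU n k i := rfl

theorem boolLift_genP (hn : 2 ≤ n) : boolLift hn (genP n) =
    ((1 : ℝ) : ℂ) • InnerProductSpace.rankOne ℂ (repSum n) (repSum n) := rfl

theorem inner_repSum_self (hn : 2 ≤ n) : inner ℂ (repSum n) (repSum n) = 1 := by
  have hn0 : (n : ℂ) ≠ 0 := by exact_mod_cast (by omega : n ≠ 0)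
  have i0 : Fin n := ⟨0, by omega⟩
  conv_lhs => rw [← sum_repVec hn i0, sum_inner, sum_repVec hn i0]
  simp [inner_repSum_repVec hn, hn0]

/-- The unit vector `repSum n` spans the range of `P`, so its vector state ignores compression by
`P` and turns identities in the corner into scalar ones. -/
theorem inner_compress (hn : 2 ≤ n) (b : Bs n) :
    inner ℂ (repSum n) (boolLift hn (genP n * b * genP n) (repSum n)) =
      inner ℂ (repSum n) (boolLift hn b (repSum n)) := by
  rw [map_mul, map_mul, boolLift_genP]
  simp only [mul_apply_eq_comp, smul_apply, InnerProductSpace.rankOne_apply, inner_smul_right,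
    inner_repSum_self hn, map_smul]
  simp

theorem boolLift_prod (hn : 2 ≤ n) (v : List (Fin n)) (j : Fin v.length → Fin n) :
    boolLift hn (List.ofFn fun q => genU n (j q) (v.get q)).prod =
      (List.zipWith (repU n) (List.ofFn j) v).prod := by
  rw [map_list_prod, List.map_ofFn]
  congr 1
  apply List.ext_getElem
  · simp
  · intro i h1 h2
    simp [boolLift_genU]

end Representation

/-! ### The invariance condition in terms of words -/

theorem basisFreeMonoid_apply {n : ℕ} (w : FreeMonoid (Fin n)) :
    FreeAlgebra.basisFreeMonoid ℂ (Fin n) w = (w.toList.map (FreeAlgebra.ι ℂ)).prod := by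
  simp [FreeAlgebra.basisFreeMonoid, FreeAlgebra.equivMonoidAlgebraFreeMonoid,
    FreeMonoid.lift_apply]

section Invariance

variable {𝒜 : Type*} [Ring 𝒜] [Algebra ℂ 𝒜]

theorem jointDist_prod (φ : 𝒜 →ₗ[ℂ] ℂ) {n : ℕ} (x : Fin n → 𝒜) (w : List (Fin n)) :
    jointDist φ x (w.map (FreeAlgebra.ι ℂ)).prod = φ (w.map x).prod := by
  simp [jointDist, map_list_prod, Function.comp_def]

/-- The invariance condition, evaluated on a monomial. -/
theorem invariance_apply (φ : 𝒜 →ₗ[ℂ] ℂ) {n : ℕ} (x : Fin n → 𝒜) (w : List (Fin n)) :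
    (TensorProduct.lid ℂ (BsCorner n) ((jointDist φ x).rTensor (BsCorner n)
      (linearCoaction n (FreeAlgebra.basisFreeMonoid ℂ (Fin n) (FreeMonoid.ofList w)))) : Bs n) =
    ∑ j : Fin w.length → Fin n, φ ((List.ofFn j).map x).prod •
      (genP n * (List.ofFn fun q => genU n (j q) (w.get q)).prod * genP n) := by
  rw [linearCoaction, Module.Basis.constr_basis]
  simp only [map_sum, LinearMap.rTensor_tmul, TensorProduct.lid_tmul, compress]
  rw [AddSubmonoidClass.coe_finsetSum]
  refine Finset.sum_congr rfl fun j _ => ?_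
  have : (List.ofFn fun q => FreeAlgebra.ι ℂ (j q)) = (List.ofFn j).map (FreeAlgebra.ι ℂ) := by
    rw [List.map_ofFn]; rfl
  rw [this, jointDist_prod]
  rfl

/-- The sum over the remaining letters reproduces `P` by induction, which leaves the relation `∑
u_{ki} P = P` for the first letter. -/
theorem sum_prod_mul_eq {D : Type*} [Ring D] [StarRing D] {n : ℕ} {u : Fin n → Fin n → D} {P : D}
    (h : BoolRel n u P) (w : List (Fin n)) :
    ∑ j : Fin w.length → Fin n, (List.ofFn fun q => u (j q) (w.get q)).prod * P = P := by
  induction w with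
  | nil => simp
  | cons i w ih =>
    have e := (Fin.consEquiv fun _ : Fin (w.length + 1) => Fin n).sum_comp
      fun j : Fin (i :: w).length → Fin n =>
        (List.ofFn fun q => u (j q) ((i :: w).get q)).prod * P
    refine e.symm.trans ?_
    rw [Fintype.sum_prod_type]
    simp only [Fin.consEquiv_apply, List.length_cons, List.ofFn_succ, Fin.cons_zero, Fin.cons_succ,
      List.get_cons_zero, List.prod_cons, mul_assoc]
    simp only [← Finset.mul_sum]
    exact (Finset.sum_congr rfl fun k _ => congrArg (u k i * ·) ih).trans (h.inv i)

theorem mul_sum_prod_mul_eq {D : Type*} [Ring D] [StarRing D] {n : ℕ} {u : Fin n → Fin n → D}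
    {P : D} (h : BoolRel n u P) (w : List (Fin n)) :
    ∑ j : Fin w.length → Fin n, P * ((List.ofFn fun q => u (j q) (w.get q)).prod * P) = P * P := by
  rw [← Finset.mul_sum, sum_prod_mul_eq h]

/-- At the first mismatch of the run patterns, one of two adjacent factors' index pairs agrees and
the other does not: the row relation or the column relation kills the product. -/
theorem prod_eq_zero_or_runEq {D : Type*} [Ring D] [StarRing D] {n : ℕ} {u : Fin n → Fin n → D}
    {P : D} (h : BoolRel n u P) (w : List (Fin n)) (j : Fin w.length → Fin n) :
    (List.ofFn fun q => u (j q) (w.get q)).prod = 0 ∨ RunEq (List.ofFn j) w := by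
  induction w with
  | nil => right; simpa using RunEq.nil
  | cons a w ih =>
    cases w with
    | nil => right; simpa using RunEq.single _ _
    | cons b w =>
      by_cases hr : j 0 = j 1 ↔ a = b
      · rcases ih (fun q => j q.succ) with h0 | h1
        · left
          have : (List.ofFn fun q => u (j q) ((a :: b :: w).get q)) = u (j 0) a ::
              List.ofFn fun q : Fin (b :: w).length => u (j q.succ) ((b :: w).get q) := by
            rw [List.ofFn_succ]; rfl
          rw [this, List.prod_cons, h0, mul_zero]
        · right
          simp only [List.length_cons, List.ofFn_succ] at h1 ⊢
          exact .cons hr h1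
      · left
        have : (List.ofFn fun q => u (j q) ((a :: b :: w).get q)) = u (j 0) a :: u (j 1) b ::
            List.ofFn fun q : Fin w.length => u (j q.succ.succ) (w.get q) := by
          rw [List.ofFn_succ, List.ofFn_succ]; rfl
        rw [this, List.prod_cons, List.prod_cons, ← mul_assoc]
        have h0 : u (j 0) a * u (j 1) b = 0 := by
          by_cases h1 : j 0 = j 1
          · rw [h1]; exact h.row _ _ _ fun h2 => hr ⟨fun _ => h2, fun _ => h1⟩
          · by_cases h2 : a = b
            · rw [h2]; exact h.col _ _ _ h1
            · exact absurd ⟨fun h => absurd h h1, fun h => absurd h h2⟩ hr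
        rw [h0, zero_mul]

/-- Each nonzero summand of the coaction carries a word with the runs of `w`, so its moment can be
replaced by that of `w` and taken out of the sum. -/
theorem satisfiesBooleanInvariance_of_runEq (φ : 𝒜 →ₗ[ℂ] ℂ) (x : ℕ → 𝒜)
    (hR : ∀ w w' : List ℕ, RunEq w w' → φ (w.map x).prod = φ (w'.map x).prod) :
    SatisfiesBooleanInvariance φ x := by
  intro n p
  set X : Fin n → 𝒜 := fun i => x i with hX
  have hR' : ∀ w w' : List (Fin n), RunEq w w' → φ (w.map X).prod = φ (w'.map X).prod := by
    intro w w' h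
    simpa [List.map_map, Function.comp_def] using
      hR _ _ (h.map Fin.val_injective Fin.val_injective)
  let L : FreeAlgebra ℂ (Fin n) →ₗ[ℂ] BsCorner n :=
    (TensorProduct.lid ℂ (BsCorner n)).toLinearMap ∘ₗ
      (jointDist φ X).rTensor (BsCorner n) ∘ₗ linearCoaction n
  suffices h : L = (jointDist φ X).smulRight (compress n 1) from LinearMap.congr_fun h p
  refine (FreeAlgebra.basisFreeMonoid ℂ (Fin n)).ext fun w => Subtype.ext ?_
  refine (invariance_apply φ X w.toList).trans ?_
  have e : ∀ j : Fin w.toList.length → Fin n, φ ((List.ofFn j).map X).prod •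
      (genP n * (List.ofFn fun q => genU n (j q) (w.toList.get q)).prod * genP n) =
      φ (w.toList.map X).prod •
      (genP n * ((List.ofFn fun q => genU n (j q) (w.toList.get q)).prod * genP n)) := by
    intro j
    rcases prod_eq_zero_or_runEq (gen_rel n) w.toList j with h | h
    · rw [h]; simp
    · rw [hR' _ _ h, mul_assoc]
  have hsum : ∑ j : Fin w.toList.length → Fin n,
      genP n * ((List.ofFn fun q => genU n (j q) (w.toList.get q)).prod * genP n) =
      genP n * genP n :=
    mul_sum_prod_mul_eq (gen_rel n) w.toList
  rw [basisFreeMonoid_apply, LinearMap.smulRight_apply, jointDist_prod]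
  refine (Finset.sum_congr rfl fun j _ => e j).trans ?_
  rw [← Finset.smul_sum]
  change _ = φ (w.toList.map X).prod • (genP n * 1 * genP n)
  rw [mul_one]
  exact congrArg _ hsum

/-- Acting on `repSum n` from the right, each rank one projection leaves a multiple of its own
vector. The scalars picked up are inner products of consecutive vectors, hence the same for both
words. -/
theorem rep_prod_apply {n : ℕ} (hn : 2 ≤ n) (w w' : List (Fin n)) (h : RunEq w w')
    (js : List (Fin n)) (hj : js.length = w.length) :
    inner ℂ (repSum n) ((List.zipWith (repU n) js w).prod (repSum n)) =
      inner ℂ (repSum n) ((List.zipWith (repU n) js w').prod (repSum n)) := by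
  have hu : ∀ (k i : Fin n) (y), repU n k i y =
      ((n : ℂ) * inner ℂ (repVec n k i) y) • repVec n k i := by
    intro k i y; simp [repU, smul_smul]
  have hP : ∀ k i, inner ℂ (repSum n) (repVec n k i) = (1 / n : ℂ) := by
    intro k i
    rw [← inner_conj_symm, inner_repSum_repVec hn]; simp
  have key : (js = [] ∧ w = [] ∧ w' = []) ∨ ∃ k js' i u i' u', js = k :: js' ∧ w = i :: u ∧
      w' = i' :: u' ∧ ∃ c : ℂ,
        (List.zipWith (repU n) js w).prod (repSum n) = c • repVec n k i ∧
        (List.zipWith (repU n) js w').prod (repSum n) = c • repVec n k i' := by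
    induction h generalizing js with
    | nil => exact .inl ⟨List.eq_nil_of_length_eq_zero hj, rfl, rfl⟩
    | single a b =>
      obtain ⟨k, rfl⟩ := List.length_eq_one_iff.1 hj
      refine .inr ⟨_, _, _, _, _, _, rfl, rfl, rfl, (n : ℂ) * (1 / n), ?_, ?_⟩ <;>
      simp [hu, inner_repSum_repVec hn]
    | @cons a a' b b' w w' hr _ ih =>
      cases js with
      | nil => simp at hj
      | cons k js =>
        right
        rcases ih js (by simpa using hj) with ⟨-, h, -⟩ | ⟨k', js', i, u, i', u', rfl, h1, h2, c, h3, h4⟩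
        · simp at h
        · rw [List.cons.injEq] at h1 h2
          obtain ⟨rfl, rfl⟩ := h1
          obtain ⟨rfl, rfl⟩ := h2
          refine ⟨_, _, _, _, _, _, rfl, rfl, rfl,
            n * (c * inner ℂ (repVec n k a) (repVec n k' a')), ?_, ?_⟩
          · rw [List.zipWith_cons_cons, List.prod_cons, mul_apply_eq_comp, h3, hu,
              inner_smul_right]
          · rw [List.zipWith_cons_cons, List.prod_cons, mul_apply_eq_comp, h4, hu,
              inner_smul_right]
            simp only [inner_repVec hn, hr]
  rcases key with ⟨rfl, rfl, rfl⟩ | ⟨k, js', i, u, i', u', rfl, rfl, rfl, c, h3, h4⟩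
  · rfl
  · rw [h3, h4, inner_smul_right, inner_smul_right, hP, hP]

/-- In the vector state at `repSum n`, invariance writes the moment of `v` as a combination of all
moments of that length, with coefficients depending on `v` only through its runs. -/
theorem runEq_of_satisfiesBooleanInvariance (φ : 𝒜 →ₗ[ℂ] ℂ) (x : ℕ → 𝒜)
    (hinv : SatisfiesBooleanInvariance φ x) (w w' : List ℕ) (h : RunEq w w') :
    φ (w.map x).prod = φ (w'.map x).prod := by
  obtain ⟨n, hn, hw, hw'⟩ : ∃ n, 2 ≤ n ∧ (∀ a ∈ w, a < n) ∧ ∀ a ∈ w', a < n :=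
    ⟨w.sum + w'.sum + 2, by omega,
      fun a ha => by have := List.single_le_sum (by simp) a ha; omega,
      fun a ha => by have := List.single_le_sum (by simp) a ha; omega⟩
  lift w to List (Fin n) using fun a ha => hw a ha
  lift w' to List (Fin n) using fun a ha => hw' a ha
  have hr : RunEq w w' := h.of_map Fin.val_injective Fin.val_injective
  set X : Fin n → 𝒜 := fun i => x i with hX
  have key : ∀ (m : ℕ) (v : List (Fin n)), v.length = m → φ (v.map X).prod =
      ∑ j : Fin m → Fin n, φ ((List.ofFn j).map X).prod * inner ℂ (repSum n)
        ((List.zipWith (repU n) (List.ofFn j) v).prod (repSum n)) := by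
    rintro m v rfl
    have h1 := hinv n (FreeAlgebra.basisFreeMonoid ℂ (Fin n) (FreeMonoid.ofList v))
    have h2 := (invariance_apply φ X v).symm.trans (congrArg Subtype.val h1)
    have hc : ((jointDist φ X (FreeAlgebra.basisFreeMonoid ℂ (Fin n) (FreeMonoid.ofList v)) •
        compress n 1 : BsCorner n) : Bs n) = φ (v.map X).prod • (genP n * 1 * genP n) := by
      rw [basisFreeMonoid_apply, FreeMonoid.toList_ofList, jointDist_prod]; rfl
    have h3 := congrArg (fun b => inner ℂ (repSum n) (boolLift hn b (repSum n))) (h2.trans hc)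
    simp only [map_sum, map_smul, sum_apply, smul_apply, inner_sum, inner_smul_right,
      inner_compress, boolLift_prod, map_one, one_apply_eq_self,
      inner_repSum_self hn] at h3
    rw [mul_one] at h3
    exact h3.symm
  simp only [List.map_map, Function.comp_def]
  rw [key w.length w rfl, key w.length w' hr.length_eq.symm]
  exact Finset.sum_congr rfl fun j _ => congrArg _ (rep_prod_apply hn w w' hr _ (by simp))

end Invariance

/-! ### Mixed moments of boolean independent variables -/

section MixedMoments

variable {𝒜 : Type*} [Ring 𝒜] [Algebra ℂ 𝒜] {ℬ : Subalgebra ℂ 𝒜}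

theorem BPoly.eval_X (x : 𝒜) : BPoly.eval ℬ x (BPoly.X ℬ) = x := by
  simp [BPoly.eval, BPoly.X]

theorem BPoly.X_mem_noConst : BPoly.X ℬ ∈ BPoly.noConst ℬ :=
  Submodule.subset_span ⟨1, 1, by simp⟩

theorem BPoly.mul_mem_noConst (f : BPoly ℬ) {p : BPoly ℬ} (hp : p ∈ BPoly.noConst ℬ) :
    f * p ∈ BPoly.noConst ℬ := by
  induction hp using Submodule.span_induction with
  | mem p h =>
    obtain ⟨g, h, rfl⟩ := h
    exact Submodule.subset_span ⟨f * g, h, by simp only [mul_assoc]⟩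
  | zero => simp
  | add p q _ _ hp hq => rw [mul_add]; exact add_mem hp hq
  | smul c p _ hp => rw [mul_smul_comm]; exact Submodule.smul_mem _ c hp

/-- Both words share one list of polynomials, a power of `X` for each run, and differ only in the
indices attached. Prepending a letter either multiplies the leading power `p` by `X` or opens a new
run. -/
theorem exists_run_decomposition (ℬ : Subalgebra ℂ 𝒜) (x : ℕ → 𝒜) {w w' : List ℕ}
    (h : RunEq w w') : (w = [] ∧ w' = []) ∨
    ∃ (a a' : ℕ) (u u' : List ℕ) (p : BPoly ℬ) (t t' : List (ℕ × BPoly ℬ)),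
      w = a :: u ∧ w' = a' :: u' ∧ t.map Prod.snd = t'.map Prod.snd ∧
      ((a, p) :: t).IsChain (fun q r => q.1 ≠ r.1) ∧
      ((a', p) :: t').IsChain (fun q r => q.1 ≠ r.1) ∧
      (∀ q ∈ (a, p) :: t, q.2 ∈ BPoly.noConst ℬ) ∧
      (w.map x).prod = (((a, p) :: t).map fun q => BPoly.eval ℬ (x q.1) q.2).prod ∧
      (w'.map x).prod = (((a', p) :: t').map fun q => BPoly.eval ℬ (x q.1) q.2).prod := by
  induction h with
  | nil => exact .inl ⟨rfl, rfl⟩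
  | single a b =>
    refine .inr ⟨a, b, [], [], BPoly.X ℬ, [], [], rfl, rfl, rfl, by simp, by simp, ?_, ?_, ?_⟩ <;>
    simp [BPoly.X_mem_noConst, BPoly.eval_X]
  | @cons a a' b b' w w' hr _ ih =>
    right
    obtain ⟨h, -⟩ | ⟨c, c', u, u', p, t, t', hc, hc', hs, h1, h2, h3, h4, h5⟩ := ih
    · simp at h
    rw [List.cons.injEq] at hc hc'
    obtain ⟨rfl, rfl⟩ := hc
    obtain ⟨rfl, rfl⟩ := hc'
    by_cases h : a = a'
    · obtain rfl := h
      obtain rfl := hr.1 rfl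
      refine ⟨a, b, _, _, BPoly.X ℬ * p, t, t', rfl, rfl, hs, ?_, ?_, ?_, ?_, ?_⟩
      · cases t with
        | nil => simp
        | cons => simpa [List.isChain_cons_cons] using h1
      · cases t' with
        | nil => simp
        | cons => simpa [List.isChain_cons_cons] using h2
      · simp only [List.mem_cons, forall_eq_or_imp] at h3 ⊢
        exact ⟨BPoly.mul_mem_noConst _ h3.1, h3.2⟩
      · rw [List.map_cons, List.prod_cons, h4]
        simp [BPoly.eval_X, mul_assoc]
      · rw [List.map_cons, List.prod_cons, h5]
        simp [BPoly.eval_X, mul_assoc]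
    · have h' : b ≠ b' := fun hb => h (hr.2 hb)
      refine ⟨a, b, _, _, BPoly.X ℬ, (a', p) :: t, (b', p) :: t', rfl, rfl, by simp [hs],
        ?_, ?_, ?_, ?_, ?_⟩
      · exact List.isChain_cons_cons.2 ⟨h, h1⟩
      · exact List.isChain_cons_cons.2 ⟨h', h2⟩
      · rw [List.forall_mem_cons]
        exact ⟨BPoly.X_mem_noConst, h3⟩
      · rw [List.map_cons, List.prod_cons, h4]
        simp [BPoly.eval_X]
      · rw [List.map_cons, List.prod_cons, h5]
        simp [BPoly.eval_X]

/-- Mixed moments of identically distributed, boolean independent variables only depend on the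
pattern of runs. -/
theorem map_prod_eq_of_runEq (E : 𝒜 →ₗ[ℂ] ℬ) (x : ℕ → 𝒜) (hid : IdentDistribOver E x)
    (hind : BooleanIndepOver E x) (w w' : List ℕ) (h : RunEq w w') :
    E (w.map x).prod = E (w'.map x).prod := by
  obtain ⟨rfl, rfl⟩ | ⟨a, a', u, u', p, t, t', rfl, rfl, hs, h1, h2, h3, h4, h5⟩ :=
    exists_run_decomposition ℬ x h
  · rfl
  have h3' : ∀ q ∈ (a', p) :: t', q.2 ∈ BPoly.noConst ℬ := by
    have e : ∀ l : List (ℕ × BPoly ℬ), (∀ q ∈ l, q.2 ∈ BPoly.noConst ℬ) ↔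
        ∀ r ∈ l.map Prod.snd, r ∈ BPoly.noConst ℬ := by
      intro l; simp only [List.forall_mem_map]
    rw [e] at h3 ⊢
    simpa [hs] using h3
  rw [h4, h5, hind _ (by simp) h1 h3, hind _ (by simp) h2 h3']
  have e : ∀ l : List (ℕ × BPoly ℬ), (l.map fun q => E (BPoly.eval ℬ (x q.1) q.2)) =
      (l.map Prod.snd).map fun r => E (BPoly.eval ℬ (x 0) r) := by
    intro l
    rw [List.map_map]
    exact List.map_congr_left fun q _ => hid _ _ _
  rw [e, e, List.map_cons, List.map_cons (f := Prod.snd), hs]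

end MixedMoments

/-! ### The Hilbert space picture -/

section Hilbert

open Filter Topology

/-- For bounded vectors, weak convergence to zero passes from test vectors in `S` to test vectors in
its closure. -/
theorem tendsto_inner_zero_of_mem_closure {V ι : Type*} [NormedAddCommGroup V]
    [InnerProductSpace ℂ V] {l : Filter ι} {v : ι → V} {C : ℝ} (hv : ∀ᶠ i in l, ‖v i‖ ≤ C) {S : Set V}
    (hS : ∀ η ∈ S, Tendsto (fun i => inner ℂ η (v i)) l (𝓝 0)) {η : V} (hη : η ∈ closure S) :
    Tendsto (fun i => inner ℂ η (v i)) l (𝓝 0) := by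
  rw [Metric.tendsto_nhds]
  intro ε hε
  have hC : 0 < |C| + 1 := by positivity
  obtain ⟨ζ, hζ, hd⟩ := Metric.mem_closure_iff.1 hη (ε / 2 / (|C| + 1)) (by positivity)
  filter_upwards [Metric.tendsto_nhds.1 (hS ζ hζ) (ε / 2) (by positivity), hv] with i hi hvi
  rw [dist_zero_right] at hi ⊢
  have h1 : inner ℂ η (v i) = inner ℂ (η - ζ) (v i) + inner ℂ ζ (v i) := by
    rw [inner_sub_left]; ring
  have h2 : ‖inner ℂ (η - ζ) (v i)‖ ≤ ε / 2 := by
    refine (norm_inner_le_norm _ _).trans ?_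
    rw [dist_eq_norm, lt_div_iff₀ hC] at hd
    refine le_trans ?_ hd.le
    gcongr
    exact hvi.trans ((le_abs_self C).trans (by linarith))
  rw [h1]
  exact (norm_add_le _ _).trans_lt (by linarith)

variable {K : Type*} [NormedAddCommGroup K] [InnerProductSpace ℂ K]

/-- The vector obtained by applying a word in the operators `X i` to `ξ`. -/
def wordVec (X : ℕ → K →L[ℂ] K) (ξ : K) (w : List ℕ) : K := (w.map X).prod ξ

variable (X : ℕ → K →L[ℂ] K) (ξ : K)

@[simp]
theorem wordVec_nil : wordVec X ξ [] = ξ := by simp [wordVec]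

theorem wordVec_cons (i : ℕ) (w : List ℕ) : wordVec X ξ (i :: w) = X i (wordVec X ξ w) := by
  simp [wordVec]

theorem wordVec_append (u w : List ℕ) :
    wordVec X ξ (u ++ w) = (u.map X).prod (wordVec X ξ w) := by
  simp [wordVec]

/-- The closed span of the words in the letters `X i`, `N ≤ i`. -/
def tailSpan (N : ℕ) : Submodule ℂ K :=
  (Submodule.span ℂ (wordVec X ξ '' {w | ∀ a ∈ w, N ≤ a})).topologicalClosure

/-- The intersection of all `tailSpan X ξ N`. -/
def tailSpace : Submodule ℂ K := ⨅ N, tailSpan X ξ N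

theorem isClosed_tailSpan (N : ℕ) : IsClosed (tailSpan X ξ N : Set K) :=
  Submodule.isClosed_topologicalClosure _

theorem isClosed_tailSpace : IsClosed (tailSpace X ξ : Set K) := by
  rw [tailSpace, Submodule.coe_iInf]
  exact isClosed_iInter fun N => isClosed_tailSpan X ξ N

variable [CompleteSpace K]

instance : CompleteSpace (tailSpace X ξ) := (isClosed_tailSpace X ξ).completeSpace_coe

/-- The projection onto `tailSpace X ξ`. -/
def tailProj : K →L[ℂ] K := (tailSpace X ξ).starProjection

theorem tailProj_mul_self : tailProj X ξ * tailProj X ξ = tailProj X ξ :=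
  (isStarProjection_starProjection (U := tailSpace X ξ)).isIdempotentElem.eq

theorem inner_tailProj (y z : K) :
    inner ℂ (tailProj X ξ y) z = inner ℂ y (tailProj X ξ z) :=
  Submodule.inner_starProjection_left_eq_right _ _ _

theorem tailProj_apply_mem (y : K) : tailProj X ξ y ∈ tailSpace X ξ :=
  Submodule.starProjection_apply_mem _ _

@[simp]
theorem tailProj_vec : tailProj X ξ ξ = ξ := by
  refine Submodule.starProjection_eq_self_iff.2 ((Submodule.mem_iInf _).2 fun N => ?_)
  -- The empty word satisfies every lower bound on its letters vacuously.
  exact Submodule.le_topologicalClosure _ (Submodule.subset_span ⟨[], by simp, by simp⟩)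

/-- The complement of an intersection of closed subspaces is the closed span of their complements.
-/
theorem orthogonal_tailSpace_le {Z : Submodule ℂ K} (hZ : IsClosed (Z : Set K))
    (h : ∀ N, (tailSpan X ξ N)ᗮ ≤ Z) : (tailSpace X ξ)ᗮ ≤ Z := by
  have h1 : tailSpace X ξ = (⨆ N, (tailSpan X ξ N)ᗮ)ᗮ := by
    rw [← Submodule.iInf_orthogonal, tailSpace]
    refine iInf_congr fun N => ?_
    rw [Submodule.orthogonal_orthogonal_eq_closure]
    exact ((isClosed_tailSpan X ξ N).submodule_topologicalClosure_eq).symm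
  rw [h1, Submodule.orthogonal_orthogonal_eq_closure]
  exact Submodule.topologicalClosure_minimal _ (iSup_le h) hZ

/-- Selfadjoint operators and a vector whose mixed moments only depend on the pattern of runs,
and for which the vector is cyclic. -/
structure RunInvariant : Prop where
  selfAdjoint : ∀ i, IsSelfAdjoint (X i)
  moment : ∀ w w' : List ℕ, RunEq w w' →
    inner ℂ ξ (wordVec X ξ w) = inner ℂ ξ (wordVec X ξ w')
  dense : (Submodule.span ℂ (Set.range (wordVec X ξ))).topologicalClosure = ⊤

namespace RunInvariant

variable {X ξ}

section Basic

variable (h : RunInvariant X ξ)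
include h

theorem inner_apply_left (i : ℕ) (y z : K) : inner ℂ (X i y) z = inner ℂ y (X i z) :=
  ContinuousLinearMap.isSelfAdjoint_iff_isSymmetric.1 (h.selfAdjoint i) y z

theorem inner_wordVec (c b : List ℕ) :
    inner ℂ (wordVec X ξ c) (wordVec X ξ b) = inner ℂ ξ (wordVec X ξ (c.reverse ++ b)) := by
  induction c generalizing b with
  | nil => simp
  | cons a c ih =>
    rw [wordVec_cons, h.inner_apply_left, ← wordVec_cons, ih]
    simp

/-- The inner product is the moment of `c` reversed followed by `b`. Separate injective relabellings
keep the runs inside each half, so only the junction, where the two heads meet, needs a condition.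
-/
theorem inner_wordVec_map {f g : ℕ → ℕ} (hf : f.Injective) (hg : g.Injective) (c b : List ℕ)
    (hcb : ∀ i ∈ c.head?, ∀ j ∈ b.head?, (i = j ↔ f i = g j)) :
    inner ℂ (wordVec X ξ c) (wordVec X ξ b) =
      inner ℂ (wordVec X ξ (c.map f)) (wordVec X ξ (b.map g)) := by
  rw [h.inner_wordVec, h.inner_wordVec, ← List.map_reverse]
  refine h.moment _ _ (.append (.map_right hf _) (.map_right hg _) ?_)
  intro i hi j hj i' hi' j' hj'
  simp only [List.getLast?_map, List.getLast?_reverse, List.head?_map, Option.mem_def,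
    Option.map_eq_some_iff] at hi hj hi' hj'
  obtain ⟨k, hk, rfl⟩ := hi'
  obtain ⟨l, hl, rfl⟩ := hj'
  obtain rfl : k = i := by simpa [hk] using hi
  obtain rfl : l = j := by simpa [hl] using hj
  exact hcb _ hk _ hl

theorem ext_inner {S T : K →L[ℂ] K}
    (hST : ∀ c b, inner ℂ (wordVec X ξ c) (S (wordVec X ξ b)) =
      inner ℂ (wordVec X ξ c) (T (wordVec X ξ b))) : S = T := by
  have hd : Dense (Submodule.span ℂ (Set.range (wordVec X ξ)) : Set K) :=
    Submodule.dense_iff_topologicalClosure_eq_top.2 h.dense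
  have h1 : ∀ b, S (wordVec X ξ b) = T (wordVec X ξ b) := by
    intro b
    refine hd.eq_of_inner_right (𝕜 := ℂ) fun y hy => ?_
    induction hy using Submodule.span_induction with
    | mem y hy => obtain ⟨c, rfl⟩ := hy; exact hST c b
    | zero => simp
    | add y z _ _ hy hz => simp only [inner_add_left, hy, hz]
    | smul a y _ hy => simp only [inner_smul_left, hy]
  refine ContinuousLinearMap.ext_on hd ?_
  rintro _ ⟨b, rfl⟩
  exact h1 b

theorem norm_wordVec_add (b : List ℕ) (M : ℕ) :
    ‖wordVec X ξ (b.map (· + M))‖ = ‖wordVec X ξ b‖ := by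
  have := h.inner_wordVec_map (add_left_injective M) (add_left_injective M) b b (by simp)
  rw [@norm_eq_sqrt_re_inner ℂ, ← this, ← @norm_eq_sqrt_re_inner ℂ]

theorem inner_wordVec_add_of_mem {ζ : K} (hζ : ζ ∈ tailSpace X ξ) (b : List ℕ) (M : ℕ) :
    inner ℂ ζ (wordVec X ξ (b.map (· + M))) = inner ℂ ζ (wordVec X ξ b) := by
  rw [← sub_eq_zero, ← inner_sub_right]
  -- Letters from this bound on differ from every letter of `b` and of its shift by `M`, so the
  -- junction never creates a coincidence.
  suffices hle : tailSpan X ξ (b.sum + M + 1) ≤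
      (ℂ ∙ (wordVec X ξ (b.map (· + M)) - wordVec X ξ b))ᗮ by
    exact Submodule.mem_orthogonal_singleton_iff_inner_left.1
      (hle ((Submodule.mem_iInf _).1 hζ _))
  refine Submodule.topologicalClosure_minimal _ (Submodule.span_le.2 ?_)
    (Submodule.isClosed_orthogonal _)
  rintro _ ⟨d, hd, rfl⟩
  refine Submodule.mem_orthogonal_singleton_iff_inner_left.2 ?_
  rw [inner_sub_right, sub_eq_zero]
  conv_lhs => rw [← List.map_id d]
  refine (h.inner_wordVec_map Function.injective_id (add_left_injective M) d b ?_).symm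
  intro i hi j hj
  have h1 := hd i (List.mem_of_mem_head? hi)
  have h2 := List.single_le_sum (by simp) j (List.mem_of_mem_head? hj)
  simp only [id]
  omega

theorem tailProj_wordVec_add (b : List ℕ) (M : ℕ) :
    tailProj X ξ (wordVec X ξ (b.map (· + M))) = tailProj X ξ (wordVec X ξ b) := by
  refine ext_inner_left ℂ fun ζ => ?_
  rw [← inner_tailProj, ← inner_tailProj]
  exact h.inner_wordVec_add_of_mem (tailProj_apply_mem X ξ ζ) b M

/-- The shifted words converge weakly. -/
theorem tendsto_inner_wordVec_add (ζ : K) (b : List ℕ) :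
    Tendsto (fun M => inner ℂ ζ (wordVec X ξ (b.map (· + M)))) atTop
      (𝓝 (inner ℂ ζ (tailProj X ξ (wordVec X ξ b)))) := by
  let Z : Submodule ℂ K :=
    { carrier := {η | Tendsto (fun M => inner ℂ η (wordVec X ξ (b.map (· + M)))) atTop (𝓝 0)}
      add_mem' := fun {η ζ} hη hζ => by
        simpa [inner_add_left] using Tendsto.add hη hζ
      zero_mem' := by simp
      smul_mem' := fun c η hη => by
        simpa [inner_smul_left, mul_comm] using Tendsto.const_mul (starRingEnd ℂ c) hη }
  have hZ : IsClosed (Z : Set K) := by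
    refine isClosed_of_closure_subset fun η hη => ?_
    exact tendsto_inner_zero_of_mem_closure (.of_forall fun M => (h.norm_wordVec_add b M).le)
      (fun ζ hζ => hζ) hη
  -- For a vector orthogonal to `tailSpan X ξ N`, the inner products are exactly zero as soon as `M
  -- ≥ N`.
  have hle : (tailSpace X ξ)ᗮ ≤ Z := by
    refine orthogonal_tailSpace_le X ξ hZ fun N η hη => ?_
    refine tendsto_const_nhds.congr' ?_
    filter_upwards [eventually_ge_atTop N] with M hM
    refine ((Submodule.mem_orthogonal' _ _).1 hη _ (Submodule.le_topologicalClosure _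
      (Submodule.subset_span ⟨_, ?_, rfl⟩))).symm
    intro a ha
    obtain ⟨a', -, rfl⟩ := List.mem_map.1 ha
    omega
  have h1 : ζ - tailProj X ξ ζ ∈ Z := hle (Submodule.sub_starProjection_mem_orthogonal ζ)
  -- On the tail component of `ζ` the sequence is constant; on the orthogonal component it tends to
  -- zero.
  have h2 : ∀ M, inner ℂ ζ (wordVec X ξ (b.map (· + M))) =
      inner ℂ (ζ - tailProj X ξ ζ) (wordVec X ξ (b.map (· + M))) +
        inner ℂ ζ (tailProj X ξ (wordVec X ξ b)) := by
    intro M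
    rw [← inner_tailProj, inner_sub_left,
      h.inner_wordVec_add_of_mem (tailProj_apply_mem X ξ ζ) b M]
    ring
  simp only [h2]
  simpa using Tendsto.add_const _ h1

/-- Different letters are separated by the tail projection. -/
theorem mul_tailProj_mul {i j : ℕ} (hij : i ≠ j) : X i * tailProj X ξ * X j = X i * X j := by
  refine h.ext_inner fun c b => ?_
  rw [mul_apply_eq_comp, mul_apply_eq_comp, mul_apply_eq_comp, ← h.inner_apply_left,
    ← h.inner_apply_left, ← wordVec_cons, ← wordVec_cons]
  -- The left side is the limit of pairings with shifts of `j :: b`. Once `M > i` the letter `j + M`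
  -- still differs from `i`, so these pairings already equal the right side.
  refine tendsto_nhds_unique (h.tendsto_inner_wordVec_add _ _) (tendsto_const_nhds.congr' ?_)
  filter_upwards [eventually_gt_atTop i] with M hM
  conv_rhs => rw [← List.map_id (i :: c)]
  refine h.inner_wordVec_map Function.injective_id (add_left_injective M) _ _ ?_
  simp [hij]
  omega

theorem apply_tailProj_wordVec {i : ℕ} {b : List ℕ} (hb : ∀ j ∈ b.head?, i ≠ j) :
    X i (tailProj X ξ (wordVec X ξ b)) = X i (wordVec X ξ b) := by
  cases b with
  | nil => simp
  | cons j b =>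
    have := congrArg (fun T => T (wordVec X ξ b)) (h.mul_tailProj_mul (hb j (by simp)))
    simpa [wordVec_cons] using this

/-- Each outer projection is absorbed by the adjacent end letter of `a`, which differs from the
letter on the other side of the projection. -/
theorem inner_tailProj_word_tailProj {a b c : List ℕ} (ha : a ≠ [])
    (hb : ∀ i ∈ a.getLast?, ∀ j ∈ b.head?, i ≠ j) (hc : ∀ i ∈ a.head?, ∀ j ∈ c.head?, i ≠ j) :
    inner ℂ (wordVec X ξ c) ((tailProj X ξ * (a.map X).prod * tailProj X ξ) (wordVec X ξ b)) =
      inner ℂ (wordVec X ξ c) ((a.map X).prod (wordVec X ξ b)) := by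
  have h1 : (a.map X).prod (tailProj X ξ (wordVec X ξ b)) = (a.map X).prod (wordVec X ξ b) := by
    obtain ⟨a', k, rfl⟩ := (List.eq_nil_or_concat' a).resolve_left ha
    have := h.apply_tailProj_wordVec (i := k) (b := b) (hb k (by simp))
    simp [this]
  rw [mul_apply_eq_comp, mul_apply_eq_comp, h1, ← inner_tailProj]
  cases a with
  | nil => exact absurd rfl ha
  | cons k a =>
    rw [List.map_cons, List.prod_cons, mul_apply_eq_comp, ← h.inner_apply_left,
      h.apply_tailProj_wordVec (hc k (by simp)), h.inner_apply_left]

/-- The tail projection does not distinguish a word from its shift, so `b` and `c` can be moved past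
all letters of `a` and of `a.map f`. The projections then drop out, and a plain moment remains in
which `a` can be relabelled. -/
theorem tailProj_word_tailProj_map {f : ℕ → ℕ} (hf : f.Injective) (a : List ℕ) :
    tailProj X ξ * (a.map X).prod * tailProj X ξ =
      tailProj X ξ * ((a.map f).map X).prod * tailProj X ξ := by
  rcases eq_or_ne a [] with rfl | ha
  · simp
  refine h.ext_inner fun c b => ?_
  set M := a.sum + (a.map f).sum + 1 with hM
  have key : ∀ a' : List ℕ, a' ≠ [] → (∀ i ∈ a', i < M) →
      inner ℂ (wordVec X ξ c) ((tailProj X ξ * (a'.map X).prod * tailProj X ξ) (wordVec X ξ b)) =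
      inner ℂ (wordVec X ξ (c.map (· + M)))
        (wordVec X ξ (a' ++ b.map (· + M))) := by
    intro a' ha' hlt
    rw [wordVec_append, ← h.inner_tailProj_word_tailProj ha', mul_apply_eq_comp, mul_apply_eq_comp,
      mul_apply_eq_comp, mul_apply_eq_comp, ← inner_tailProj, ← inner_tailProj,
      h.tailProj_wordVec_add, h.tailProj_wordVec_add]
    · intro i hi j hj
      have := hlt i (List.mem_of_mem_getLast? hi)
      obtain ⟨j', -, rfl⟩ := List.mem_map.1 (List.mem_of_mem_head? hj)
      omega
    · intro i hi j hj
      have := hlt i (List.mem_of_mem_head? hi)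
      obtain ⟨j', -, rfl⟩ := List.mem_map.1 (List.mem_of_mem_head? hj)
      omega
  have h1 : ∀ i ∈ a, i < M := fun i hi => by
    have := List.single_le_sum (by simp) i hi
    omega
  have h2 : ∀ i ∈ a.map f, i < M := fun i hi => by
    have := List.single_le_sum (by simp) i hi
    omega
  have ha' : a.map f ≠ [] := by simpa using ha
  rw [key a ha h1, key _ ha' h2, h.inner_wordVec, h.inner_wordVec]
  refine h.moment _ _ (.append (.refl _) (.append (.map_right hf _) (.refl _) ?_) ?_)
  · intro i hi j hj i' hi' j' hj'
    have e1 := h1 i (List.mem_of_mem_getLast? hi)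
    have e2 := h2 i' (List.mem_of_mem_getLast? hi')
    obtain ⟨k, -, rfl⟩ := List.mem_map.1 (List.mem_of_mem_head? hj)
    obtain ⟨l, -, rfl⟩ := List.mem_map.1 (List.mem_of_mem_head? hj')
    omega
  · intro i hi j hj i' hi' j' hj'
    rw [List.head?_append_of_ne_nil _ ha] at hj
    rw [List.head?_append_of_ne_nil _ ha'] at hj'
    have e1 := h1 j (List.mem_of_mem_head? hj)
    have e2 := h2 j' (List.mem_of_mem_head? hj')
    rw [← List.map_reverse] at hi hi'
    obtain ⟨k, -, rfl⟩ := List.mem_map.1 (List.mem_of_mem_getLast? hi)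
    obtain ⟨l, -, rfl⟩ := List.mem_map.1 (List.mem_of_mem_getLast? hi')
    omega

end Basic

end RunInvariant

end Hilbert

/-! ### Bounded approximation in the strong operator topology -/

section Density

open Filter Topology

/-! ### The bounded transform and its resolvent identity -/

section Resolvent

variable {D : Type*} [CStarAlgebra D]

/-- The bounded transform `a ↦ a (1 + a²)⁻¹`. -/
def bddTransform (a : D) : D := cfc (fun t : ℝ => t * (1 + t ^ 2)⁻¹) a

/-- The resolvent `a ↦ (1 + a²)⁻¹`. -/
def sqResolvent (a : D) : D := cfc (fun t : ℝ => (1 + t ^ 2)⁻¹) a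

theorem continuous_inv_one_add_sq : Continuous fun t : ℝ => (1 + t ^ 2)⁻¹ :=
  Continuous.inv₀ (by fun_prop) fun t => by positivity

variable {a b : D}

theorem mul_sqResolvent (ha : IsSelfAdjoint a) : a * sqResolvent a = bddTransform a := by
  have hc := continuous_inv_one_add_sq
  rw [bddTransform, cfc_mul _ _ a (by fun_prop) hc.continuousOn, cfc_id' ℝ a, sqResolvent]

theorem sqResolvent_mul (ha : IsSelfAdjoint a) : sqResolvent a * a = bddTransform a := by
  rw [← mul_sqResolvent ha]
  conv_lhs => rw [← cfc_id ℝ a, cfc_id ℝ a]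
  nth_rewrite 2 [← cfc_id' ℝ a]
  nth_rewrite 3 [← cfc_id' ℝ a]
  exact (cfc_commute_cfc _ _ a).eq

theorem one_add_sq_mul_sqResolvent (ha : IsSelfAdjoint a) :
    (1 + a * a) * sqResolvent a = 1 := by
  have hc := continuous_inv_one_add_sq
  have h1 : 1 + a * a = cfc (fun t : ℝ => 1 + t ^ 2) a := by
    rw [cfc_const_add (1 : ℝ) (fun t => t ^ 2) a, cfc_pow_id a 2, map_one, sq]
  rw [h1, sqResolvent, ← cfc_mul _ _ a (by fun_prop) hc.continuousOn, ← cfc_const_one ℝ a]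
  refine cfc_congr fun t _ => ?_
  have : (1 : ℝ) + t ^ 2 ≠ 0 := by positivity
  field_simp

theorem sqResolvent_mul_one_add_sq (ha : IsSelfAdjoint a) :
    sqResolvent a * (1 + a * a) = 1 := by
  have h1 := one_add_sq_mul_sqResolvent ha
  have h2 : Commute (sqResolvent a) a := by
    rw [Commute, SemiconjBy, mul_sqResolvent ha, sqResolvent_mul ha]
  exact ((Commute.one_right _).add_right (h2.mul_right h2)).eq.trans h1

theorem norm_sqResolvent_le (a : D) : ‖sqResolvent a‖ ≤ 1 := by
  refine norm_cfc_le zero_le_one fun t _ => ?_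
  rw [Real.norm_eq_abs, abs_of_pos (by positivity)]
  exact inv_le_one_of_one_le₀ (by nlinarith [sq_nonneg t])

theorem norm_bddTransform_le (a : D) : ‖bddTransform a‖ ≤ 1 := by
  refine norm_cfc_le zero_le_one fun t _ => ?_
  have : (0 : ℝ) < 1 + t ^ 2 := by positivity
  rw [← div_eq_mul_inv, Real.norm_eq_abs, abs_div, abs_of_pos this, div_le_one this]
  nlinarith [sq_nonneg (|t| - 1), sq_abs t, abs_nonneg t]

/-- The function vanishes at zero, so the non-unital functional calculus applies. -/
theorem bddTransform_mem {M : NonUnitalStarSubalgebra ℂ D} (hM : IsClosed (M : Set D))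
    (ha : a ∈ M) : bddTransform a ∈ M := by
  have hc : Continuous fun t : ℝ => t * (1 + t ^ 2)⁻¹ := continuous_id.mul continuous_inv_one_add_sq
  rw [bddTransform, ← cfcₙ_eq_cfc hc.continuousOn (by simp)]
  exact cfcₙ_mem (𝕜' := ℂ) (hs := hM) _ ha

/-- On the left of each difference stand only contractions depending on `b`, on the right only
elements depending on `a`. Closeness of `b` to `a` on finitely many vectors fixed in advance thus
controls the transforms, without any bound on `‖b‖`. -/
theorem bddTransform_sub (ha : IsSelfAdjoint a) (hb : IsSelfAdjoint b) :
    bddTransform b - bddTransform a = sqResolvent b * (b - a) * sqResolvent a +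
      bddTransform b * (a - b) * (a * sqResolvent a) := by
  have h1 : bddTransform b = sqResolvent b * b * ((1 + a * a) * sqResolvent a) := by
    rw [one_add_sq_mul_sqResolvent ha, mul_one, sqResolvent_mul hb]
  have h2 : bddTransform a = sqResolvent b * (1 + b * b) * (a * sqResolvent a) := by
    rw [sqResolvent_mul_one_add_sq hb, one_mul, mul_sqResolvent ha]
  conv_lhs => rw [h1, h2]
  rw [← sqResolvent_mul hb]
  noncomm_ring

/-- The difference is `a³ (1 + a²)⁻¹`. The cubic order lets the rescaled transforms `n f(a/n)`
converge to `a` in norm. -/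
theorem norm_sub_bddTransform_le (ha : IsSelfAdjoint a) : ‖a - bddTransform a‖ ≤ ‖a‖ ^ 3 := by
  have h1 : a - bddTransform a = a * a * a * sqResolvent a := by
    have h2 : a * ((1 + a * a) * sqResolvent a) = a := by
      rw [one_add_sq_mul_sqResolvent ha, mul_one]
    rw [← mul_sqResolvent ha, sub_eq_iff_eq_add]
    conv_lhs => rw [← h2]
    noncomm_ring
  calc ‖a - bddTransform a‖ ≤ ‖a * a * a‖ * ‖sqResolvent a‖ := h1 ▸ norm_mul_le _ _
    _ ≤ ‖a * a * a‖ * 1 := by gcongr; exact norm_sqResolvent_le a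
    _ ≤ ‖a‖ ^ 3 := by
      rw [mul_one, pow_succ, sq]
      exact (norm_mul_le _ _).trans (by gcongr; exact norm_mul_le _ _)

theorem tendsto_smul_bddTransform (ha : IsSelfAdjoint a) :
    Tendsto (fun n : ℕ => ((n : ℂ) + 1) • bddTransform (((n : ℂ) + 1)⁻¹ • a)) atTop (𝓝 a) := by
  rw [tendsto_iff_norm_sub_tendsto_zero]
  have hlim : Tendsto (fun n : ℕ => ‖a‖ ^ 3 * (1 / ((n : ℝ) + 1))) atTop (𝓝 0) := by
    simpa using tendsto_one_div_add_atTop_nhds_zero_nat.const_mul (‖a‖ ^ 3)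
  refine squeeze_zero (fun _ => norm_nonneg _) (fun n => ?_) hlim
  have hn : (0 : ℝ) < (n : ℝ) + 1 := by positivity
  have hn' : (n : ℂ) + 1 ≠ 0 := by exact_mod_cast hn.ne'
  have hnorm : ‖(n : ℂ) + 1‖ = (n : ℝ) + 1 := by
    rw [← Complex.ofReal_natCast, ← Complex.ofReal_one, ← Complex.ofReal_add, Complex.norm_real,
      Real.norm_of_nonneg hn.le]
  have hsa : IsSelfAdjoint (((n : ℂ) + 1)⁻¹ • a) := by
    refine IsSelfAdjoint.smul ?_ ha
    simp [IsSelfAdjoint]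
  have h1 : ((n : ℂ) + 1) • bddTransform (((n : ℂ) + 1)⁻¹ • a) - a =
      -(((n : ℂ) + 1) • (((n : ℂ) + 1)⁻¹ • a - bddTransform (((n : ℂ) + 1)⁻¹ • a))) := by
    rw [smul_sub, smul_inv_smul₀ hn']
    abel
  rw [h1, norm_neg, norm_smul, hnorm]
  calc ((n : ℝ) + 1) * ‖((n : ℂ) + 1)⁻¹ • a - bddTransform (((n : ℂ) + 1)⁻¹ • a)‖
      ≤ ((n : ℝ) + 1) * ‖((n : ℂ) + 1)⁻¹ • a‖ ^ 3 := by
        gcongr; exact norm_sub_bddTransform_le hsa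
    _ = ‖a‖ ^ 3 * (1 / ((n : ℝ) + 1)) * (1 / ((n : ℝ) + 1)) := by
        rw [norm_smul, norm_inv, hnorm]; field_simp
    _ ≤ ‖a‖ ^ 3 * (1 / ((n : ℝ) + 1)) := by
        refine mul_le_of_le_one_right (by positivity) ?_
        rw [div_le_one hn]; linarith [(Nat.cast_nonneg n : (0 : ℝ) ≤ n)]

end Resolvent

/-! ### From weak closures to bounded strong limits -/

section StrongApproximation

variable {H : Type*} [NormedAddCommGroup H] [InnerProductSpace ℂ H] [CompleteSpace H]
variable {D : Type*} [CStarAlgebra D] (ρ : D →⋆ₐ[ℂ] (H →L[ℂ] H))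

/-- An operator, as an element of the space of operators with the weak operator topology. -/
def repWOT (a : D) : H →WOT[ℂ] H := ContinuousLinearMapWOT.ofCLM (ρ a)

/-- `repWOT` as a linear map. -/
def repWOTₗ : D →ₗ[ℂ] (H →WOT[ℂ] H) where
  toFun := repWOT ρ
  map_add' a b := by simp [repWOT]
  map_smul' c a := by simp [repWOT]

theorem star_repWOT (a : D) : star (repWOT ρ a) = repWOT ρ (star a) := by
  apply ContinuousLinearMapWOT.toCLM_injective
  exact (map_star ρ a).symm

/-- This is the double orthogonal complement over the reals, the scalars over which the selfadjoint
elements form a subspace. -/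
theorem mem_closure_image_of_re_inner {V : Type*} [NormedAddCommGroup V] [InnerProductSpace ℂ V]
    [CompleteSpace V] (L : D →ₗ[ℂ] V) (S : Submodule ℝ D) (a : D)
    (h : ∀ η, (∀ b ∈ S, (inner ℂ η (L b)).re = 0) → (inner ℂ η (L a)).re = 0) :
    L a ∈ closure (L '' S) := by
  let _ : InnerProductSpace ℝ V := InnerProductSpace.complexToReal
  have hcl : L a ∈ (S.map (L.restrictScalars ℝ)).topologicalClosure := by
    rw [← Submodule.orthogonal_orthogonal_eq_closure (𝕜 := ℝ) (E := V) (S.map (L.restrictScalars ℝ))]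
    refine (Submodule.mem_orthogonal _ _).2 fun η hη => ?_
    refine h η fun b hb => ?_
    exact (Submodule.mem_orthogonal' _ _).1 hη _ ⟨b, hb, rfl⟩
  exact hcl

/-- A selfadjoint element in the weak operator closure of a `*`-algebra can be approximated by
selfadjoint elements of the algebra in the strong operator topology. -/
theorem exists_selfAdjoint_approx (M : NonUnitalStarSubalgebra ℂ D) {a : D} (ha : IsSelfAdjoint a)
    (hM : repWOT ρ a ∈ closure (repWOT ρ '' M)) {ι : Type*} [Fintype ι] (y : ι → H) {ε : ℝ}
    (hε : 0 < ε) : ∃ b ∈ M, IsSelfAdjoint b ∧ ∀ i, ‖ρ b (y i) - ρ a (y i)‖ < ε := by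
  -- In the Hilbert sum, approximation at finitely many vectors becomes approximation of a single
  -- vector.
  let V := PiLp 2 fun _ : ι => H
  let L : D →ₗ[ℂ] V :=
    { toFun := fun b => WithLp.toLp 2 fun i => ρ b (y i)
      map_add' := fun b c => by simp only [map_add, add_apply]; rfl
      map_smul' := fun r b => by simp only [map_smul, smul_apply]; rfl }
  let Msa : Submodule ℝ D :=
    { carrier := {b | b ∈ M ∧ IsSelfAdjoint b}
      add_mem' := fun hb hc => ⟨add_mem hb.1 hc.1, hb.2.add hc.2⟩
      zero_mem' := ⟨zero_mem _, .zero _⟩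
      smul_mem' := fun r b hb => by
        refine ⟨?_, IsSelfAdjoint.smul (.all r) hb.2⟩
        rw [← Complex.coe_smul]
        exact SMulMemClass.smul_mem _ hb.1 }
  have hcl : L a ∈ closure (L '' Msa) := by
    refine mem_closure_image_of_re_inner L Msa a fun η hη => ?_
    -- Symmetrizing with the adjoint, which is weakly continuous, carries the orthogonality from
    -- selfadjoint elements of `M` to all of `M` and then to its weak closure.
    let Φ : (H →WOT[ℂ] H) → ℂ := fun T => ∑ i, (inner ℂ (η i) (T (y i)) + inner ℂ (η i) (star T (y i)))
    have hΦ : Continuous Φ := by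
      have hc := fun i : ι => (ContinuousLinearMapWOT.continuous_iff.1
        (continuous_id (X := H →WOT[ℂ] H))) (y i) (η i)
      refine continuous_finsetSum _ fun i _ => (hc i).add ((hc i).comp continuous_star)
    have hΦL : ∀ b : D, (Φ (repWOT ρ b)).re = (inner ℂ η (L (b + star b))).re := by
      intro b
      rw [PiLp.inner_apply]
      refine congrArg Complex.re (Finset.sum_congr rfl fun i _ => ?_)
      change _ = inner ℂ (η i) (ρ (b + star b) (y i))
      rw [star_repWOT, map_add, add_apply, inner_add_right]
      rfl
    have h0 : (Φ (repWOT ρ a)).re = 0 := by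
      have hc : IsClosed {T : H →WOT[ℂ] H | (Φ T).re = 0} :=
        isClosed_eq (Complex.continuous_re.comp hΦ) continuous_const
      refine closure_minimal ?_ hc hM
      rintro _ ⟨b, hb, rfl⟩
      have hb' : b + star b ∈ Msa := ⟨add_mem hb (star_mem hb), .add_star_self b⟩
      simp only [Set.mem_ofPred_eq, hΦL]
      exact hη _ hb'
    rw [hΦL, ha.star_eq, map_add, inner_add_right, Complex.add_re] at h0
    linarith
  obtain ⟨_, ⟨b, hb, rfl⟩, hd⟩ := Metric.mem_closure_iff.1 hcl ε hε
  refine ⟨b, hb.1, hb.2, fun i => ?_⟩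
  rw [dist_comm, dist_eq_norm] at hd
  exact (PiLp.norm_apply_le (L b - L a) i).trans_lt hd

/-- Variant of the Kaplansky density theorem: a norm closed subspace which is closed under bounded
strong limits and contains a `*`-algebra contains the weak operator closure of the latter. -/
theorem mem_of_mem_closure_WOT (M : NonUnitalStarSubalgebra ℂ D) (C : Submodule ℂ D)
    (hMC : (M : Set D) ⊆ C) (hC : IsClosed (C : Set D))
    (hlim : ∀ (c : D) (r : ℝ) (b : Finset H × ℕ → D), (∀ i, b i ∈ C) → (∀ i, ‖b i‖ ≤ r) →
      (∀ y, Tendsto (fun i => ρ (b i) y) atTop (𝓝 (ρ c y))) → c ∈ C)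
    {a : D} (hM : repWOT ρ a ∈ closure (repWOT ρ '' M)) : a ∈ C := by
  have hcl : (M.topologicalClosure : Set D) ⊆ C := closure_minimal hMC hC
  -- the bounded transform of a selfadjoint element
  have h1 : ∀ a : D, IsSelfAdjoint a → repWOT ρ a ∈ closure (repWOT ρ '' M) →
      bddTransform a ∈ C := by
    intro a ha hM
    have hex : ∀ i : Finset H × ℕ, ∃ b ∈ M, IsSelfAdjoint b ∧ ∀ y ∈ i.1,
        ‖ρ (bddTransform b) y - ρ (bddTransform a) y‖ ≤ 2 * (1 / ((i.2 : ℝ) + 1)) := by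
      rintro ⟨s, n⟩
      have hn : (0 : ℝ) < 1 / ((n : ℝ) + 1) := by positivity
      -- By `bddTransform_sub`, closeness is needed only at these two vectors for each `y` in `s`.
      obtain ⟨b, hbM, hb, hby⟩ := exists_selfAdjoint_approx ρ M ha hM
        (fun q : s × Bool => bif q.2 then ρ (sqResolvent a) q.1 else ρ (a * sqResolvent a) q.1) hn
      refine ⟨b, hbM, hb, fun y hy => ?_⟩
      have e1 := hby (⟨y, hy⟩, true)
      have e2 := hby (⟨y, hy⟩, false)
      simp only [cond_true, cond_false] at e1 e2
      have e3 : ρ (bddTransform b) y - ρ (bddTransform a) y =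
          ρ (sqResolvent b) (ρ b (ρ (sqResolvent a) y) - ρ a (ρ (sqResolvent a) y)) +
          ρ (bddTransform b) (ρ a (ρ (a * sqResolvent a) y) - ρ b (ρ (a * sqResolvent a) y)) := by
        rw [← sub_apply, ← map_sub, bddTransform_sub ha hb]
        simp
      have hop : ∀ (c : D) (z : H), ‖c‖ ≤ 1 → ‖ρ c z‖ ≤ ‖z‖ := fun c z hc =>
        ((ρ c).le_opNorm z).trans (mul_le_of_le_one_left (norm_nonneg _)
          ((NonUnitalStarAlgHom.norm_apply_le ρ c).trans hc))
      rw [e3]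
      refine (norm_add_le _ _).trans ?_
      have e4 := hop _ (ρ b (ρ (sqResolvent a) y) - ρ a (ρ (sqResolvent a) y))
        (norm_sqResolvent_le b)
      have e5 := hop _ (ρ a (ρ (a * sqResolvent a) y) - ρ b (ρ (a * sqResolvent a) y))
        (norm_bddTransform_le b)
      rw [norm_sub_rev] at e5
      linarith [e4.trans e1.le, e5.trans e2.le]
    choose b hbM hb hby using hex
    -- The approximants `b i` may be unbounded, but their transforms are contractions.
    refine hlim _ 1 (fun i => bddTransform (b i)) (fun i => ?_) (fun i => norm_bddTransform_le _) ?_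
    · exact hcl (bddTransform_mem M.isClosed_topologicalClosure
        (M.le_topologicalClosure (hbM i)))
    · intro y
      rw [tendsto_iff_norm_sub_tendsto_zero]
      have hl : Tendsto (fun i : Finset H × ℕ => 2 * (1 / ((i.2 : ℝ) + 1))) atTop (𝓝 0) := by
        have := (tendsto_one_div_add_atTop_nhds_zero_nat (𝕜 := ℝ)).const_mul 2
        rw [mul_zero] at this
        rw [← prod_atTop_atTop_eq]
        exact this.comp tendsto_snd
      refine squeeze_zero' (.of_forall fun _ => norm_nonneg _) ?_ hl
      filter_upwards [eventually_ge_atTop (({y} : Finset H), 0)] with i hi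
      exact hby i y (hi.1 (by simp))
  have h2 : ∀ a : D, IsSelfAdjoint a → repWOT ρ a ∈ closure (repWOT ρ '' M) → a ∈ C := by
    intro a ha hM
    refine hC.mem_of_tendsto (tendsto_smul_bddTransform ha) (.of_forall fun n => ?_)
    refine C.smul_mem _ (h1 _ ?_ ?_)
    · refine IsSelfAdjoint.smul ?_ ha
      simp [IsSelfAdjoint]
    · let W := (Submodule.map (repWOTₗ ρ) M.toSubmodule).topologicalClosure
      change repWOTₗ ρ (_ • a) ∈ W
      rw [map_smul]
      exact W.smul_mem _ hM
  have hstar : repWOT ρ (star a) ∈ closure (repWOT ρ '' M) := by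
    rw [← star_repWOT]
    refine map_mem_closure continuous_star hM ?_
    rintro _ ⟨b, hb, rfl⟩
    exact ⟨star b, star_mem hb, (star_repWOT ρ b).symm⟩
  let W := (Submodule.map (repWOTₗ ρ) M.toSubmodule).topologicalClosure
  have hre : repWOT ρ (a + star a) ∈ closure (repWOT ρ '' M) := by
    change repWOTₗ ρ _ ∈ W
    rw [map_add]
    exact W.add_mem hM hstar
  have him : repWOT ρ (Complex.I • (a - star a)) ∈ closure (repWOT ρ '' M) := by
    change repWOTₗ ρ _ ∈ W
    rw [map_smul, map_sub]
    exact W.smul_mem _ (W.sub_mem hM hstar)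
  have h3 := h2 _ (.add_star_self a) hre
  have h4 := h2 _ (by
    rw [IsSelfAdjoint, star_smul, star_sub, star_star, Complex.star_def, Complex.conj_I, neg_smul,
      ← smul_neg, neg_sub]) him
  have h5 : a = (2⁻¹ : ℂ) • ((a + star a) - Complex.I • Complex.I • (a - star a)) := by
    rw [smul_smul, Complex.I_mul_I, neg_one_smul, sub_neg_eq_add, add_add_sub_cancel,
      ← two_smul ℂ a, inv_smul_smul₀ two_ne_zero]
  rw [h5]
  exact C.smul_mem _ (C.sub_mem h3 (C.smul_mem _ h4))

end StrongApproximation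

end Density

/-! ### The weak operator topology on a von Neumann algebra -/

section WeakOperator

open Filter Topology

variable {H : Type*} [NormedAddCommGroup H] [InnerProductSpace ℂ H] [CompleteSpace H]

theorem isClosed_vonNeumann (A : VonNeumannAlgebra H) :
    IsClosed (A.toStarSubalgebra : Set (H →L[ℂ] H)) := by
  rw [VonNeumannAlgebra.coe_toStarSubalgebra, ← A.centralizer_centralizer]
  exact Set.isClosed_centralizer _

attribute [local instance] isClosed_vonNeumann

variable {A : VonNeumannAlgebra H}

/-- Convergence in the weak operator topology of a von Neumann algebra. -/
def WTendsto (l : Filter A.toStarSubalgebra) (a : A.toStarSubalgebra) : Prop :=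
  ∀ y z : H, Tendsto (fun b : A.toStarSubalgebra => inner ℂ y ((b : H →L[ℂ] H) z)) l
    (𝓝 (inner ℂ y ((a : H →L[ℂ] H) z)))

theorem wTendsto_iff {l : Filter A.toStarSubalgebra} {a : A.toStarSubalgebra} :
    WTendsto l a ↔ Tendsto (toWOT A) l (𝓝 (toWOT A a)) := by
  rw [ContinuousLinearMapWOT.tendsto_iff_forall_inner_apply_tendsto]
  exact forall_comm

theorem wTendsto_iff_le {l : Filter A.toStarSubalgebra} {a : A.toStarSubalgebra} :
    WTendsto l a ↔ l ≤ @nhds _ (wotTopology A) a := by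
  rw [wTendsto_iff, tendsto_iff_comap, ← nhds_induced]

theorem WTendsto.mono {l l' : Filter A.toStarSubalgebra} {a : A.toStarSubalgebra}
    (h : WTendsto l a) (hl : l' ≤ l) : WTendsto l' a := fun y z => (h y z).mono_left hl

theorem wTendsto_of_norm {l : Filter A.toStarSubalgebra} {a : A.toStarSubalgebra}
    (h : l ≤ 𝓝 a) : WTendsto l a := by
  intro y z
  have hc : Continuous fun b : A.toStarSubalgebra => inner ℂ y ((b : H →L[ℂ] H) z) := by fun_prop
  exact (hc.tendsto a).mono_left h

theorem WTendsto.mul_mul {l : Filter A.toStarSubalgebra} {a : A.toStarSubalgebra}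
    (h : WTendsto l a) (b c : A.toStarSubalgebra) :
    WTendsto (l.map fun d => b * d * c) (b * a * c) := by
  intro y z
  rw [tendsto_map'_iff]
  have e : ∀ d : A.toStarSubalgebra, inner ℂ y (((b * d * c : A.toStarSubalgebra) : H →L[ℂ] H) z) =
      inner ℂ (star (b : H →L[ℂ] H) y) ((d : H →L[ℂ] H) ((c : H →L[ℂ] H) z)) := by
    intro d
    rw [ContinuousLinearMap.star_eq_adjoint, ContinuousLinearMap.adjoint_inner_left]
    rfl
  simp only [Function.comp_def, e]
  exact h _ _

theorem WTendsto.sub_smul_one {l : Filter A.toStarSubalgebra} {a : A.toStarSubalgebra}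
    (h : WTendsto l a) {f : A.toStarSubalgebra → ℂ} {c : ℂ} (hf : Tendsto f l (𝓝 c)) :
    WTendsto (l.map fun b => b - f b • 1) (a - c • 1) := by
  intro y z
  rw [tendsto_map'_iff]
  have e : ∀ (d : A.toStarSubalgebra) (r : ℂ),
      inner ℂ y (((d - r • 1 : A.toStarSubalgebra) : H →L[ℂ] H) z) =
      inner ℂ y ((d : H →L[ℂ] H) z) - r * inner ℂ y z := by
    intro d r
    rw [← inner_smul_right, ← inner_sub_right]
    rfl
  simp only [Function.comp_def, e]
  exact (h y z).sub (hf.mul_const _)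

/-- Normality, in terms of filters. -/
theorem IsNormalMap.tendsto {Y : Type*} [TopologicalSpace Y] {f : A.toStarSubalgebra → Y}
    (hf : IsNormalMap f) {l : Filter A.toStarSubalgebra} {a : A.toStarSubalgebra} {r : ℝ}
    (hl : ∀ᶠ b in l, ‖b‖ ≤ r) (h : WTendsto l a) : Tendsto f l (𝓝 (f a)) := by
  have h1 := hf (max r ‖a‖) a (by simp)
  refine h1.mono_left (le_inf (wTendsto_iff_le.1 h) (le_principal_iff.2 ?_))
  filter_upwards [hl] with b hb using hb.trans (le_max_left _ _)

theorem isNormalMap_of_tendsto {Y : Type*} [TopologicalSpace Y] {f : A.toStarSubalgebra → Y}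
    (h : ∀ (l : Filter A.toStarSubalgebra) (a : A.toStarSubalgebra) (r : ℝ),
      (∀ᶠ b in l, ‖b‖ ≤ r) → WTendsto l a → Tendsto f l (𝓝 (f a))) : IsNormalMap f := by
  intro r a _
  refine h _ a r ?_ (wTendsto_iff_le.2 inf_le_left)
  exact mem_inf_of_right (mem_principal_self _)

/-- Commutation with a fixed operator passes to weak limits, and the algebra is its own double
commutant. -/
theorem mem_of_forall_tendsto_inner {l : Filter A.toStarSubalgebra} [NeBot l] {T : H →L[ℂ] H}
    (h : ∀ y z : H, Tendsto (fun b : A.toStarSubalgebra => inner ℂ y ((b : H →L[ℂ] H) z)) l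
      (𝓝 (inner ℂ y (T z)))) : T ∈ A.toStarSubalgebra := by
  change T ∈ (A : Set (H →L[ℂ] H))
  rw [← A.centralizer_centralizer]
  intro g hg
  ext1 z
  refine ext_inner_left ℂ fun y => ?_
  have h1 := h (star g y) z
  have h2 := h y (g z)
  have h3 : inner ℂ (star g y) (T z) = inner ℂ y (T (g z)) := by
    refine tendsto_nhds_unique h1 (h2.congr fun b => ?_)
    rw [ContinuousLinearMap.star_eq_adjoint, ContinuousLinearMap.adjoint_inner_left]
    exact congrArg (fun S : H →L[ℂ] H => inner ℂ y (S z)) (hg b b.2)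
  rw [ContinuousLinearMap.star_eq_adjoint, ContinuousLinearMap.adjoint_inner_left] at h3
  exact h3

/-- Norm bounded sets are relatively compact for the weak operator topology. -/
theorem exists_wTendsto (u : Ultrafilter A.toStarSubalgebra) {r : ℝ}
    (hu : ∀ᶠ b in (u : Filter A.toStarSubalgebra), ‖b‖ ≤ r) :
    ∃ a : A.toStarSubalgebra, WTendsto (u : Filter A.toStarSubalgebra) a := by
  -- Along an ultrafilter each matrix coefficient, confined to a compact disc, converges. The limits
  -- form a bounded sesquilinear form, hence an operator.
  have hB : ∀ y z : H, ∃ c ∈ Metric.closedBall (0 : ℂ) (r * ‖y‖ * ‖z‖),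
      Tendsto (fun b : A.toStarSubalgebra => inner ℂ ((b : H →L[ℂ] H) y) z) u (𝓝 c) := by
    intro y z
    refine (isCompact_closedBall (0 : ℂ) (r * ‖y‖ * ‖z‖)).ultrafilter_le_nhds
      (u.map fun b : A.toStarSubalgebra => inner ℂ ((b : H →L[ℂ] H) y) z) ?_
    rw [le_principal_iff]
    change ∀ᶠ b in (u : Filter A.toStarSubalgebra), _
    filter_upwards [hu] with b hb
    rw [mem_closedBall_zero_iff]
    refine (norm_inner_le_norm _ _).trans ?_
    gcongr
    exact ((b : H →L[ℂ] H).le_opNorm y).trans (by gcongr; exact hb)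
  choose B hBr hBt using hB
  let L : H →ₗ⋆[ℂ] H →ₗ[ℂ] ℂ := LinearMap.mk₂'ₛₗ (starRingEnd ℂ) (RingHom.id ℂ) B
    (fun y y' z => tendsto_nhds_unique (hBt _ _) (by
      simpa [inner_add_left] using (hBt y z).add (hBt y' z)))
    (fun c y z => tendsto_nhds_unique (hBt _ _) (by
      simpa [inner_smul_left, mul_comm] using (hBt y z).const_mul (starRingEnd ℂ c)))
    (fun y z z' => tendsto_nhds_unique (hBt _ _) (by
      simpa [inner_add_right] using (hBt y z).add (hBt y z')))
    (fun c y z => tendsto_nhds_unique (hBt _ _) (by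
      simpa [inner_smul_right] using (hBt y z).const_mul c))
  let T : H →L[ℂ] H := InnerProductSpace.continuousLinearMapOfBilin
    (L.mkContinuous₂ r fun y z => mem_closedBall_zero_iff.1 (hBr y z))
  have hT : ∀ y z, inner ℂ (T y) z = B y z := fun y z =>
    InnerProductSpace.continuousLinearMapOfBilin_apply _ _ _
  have hlim : ∀ y z : H, Tendsto (fun b : A.toStarSubalgebra => inner ℂ y ((b : H →L[ℂ] H) z)) u
      (𝓝 (inner ℂ y (T z))) := by
    intro y z
    have := (Complex.continuous_conj.tendsto _).comp (hBt z y)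
    rw [← hT, inner_conj_symm] at this
    refine this.congr fun b => ?_
    exact inner_conj_symm _ _
  exact ⟨⟨T, mem_of_forall_tendsto_inner hlim⟩, hlim⟩

theorem mem_vN_iff {S : Set A.toStarSubalgebra} {a : A.toStarSubalgebra} :
    a ∈ vN S ↔ toWOT A a ∈ closure (toWOT A '' (Algebra.adjoin ℂ S : Set _)) :=
  Iff.rfl

theorem wStar_mono {S S' : Set A.toStarSubalgebra} (h : S ⊆ S') : wStar S ≤ wStar S' :=
  fun _ ha => closure_mono (Set.image_mono (NonUnitalAlgebra.adjoin_mono h)) ha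

theorem subset_wStar (S : Set A.toStarSubalgebra) :
    (NonUnitalAlgebra.adjoin ℂ S : Set A.toStarSubalgebra) ⊆ wStar S :=
  fun a ha => subset_closure ⟨a, ha, rfl⟩

theorem WTendsto.mem_wStar {S : Set A.toStarSubalgebra} {l : Filter A.toStarSubalgebra} [NeBot l]
    {a : A.toStarSubalgebra} (h : WTendsto l a) (hl : ∀ᶠ b in l, b ∈ wStar S) : a ∈ wStar S :=
  isClosed_closure.mem_of_tendsto (wTendsto_iff.1 h) hl

theorem exists_sub_mem_adjoin {R : Type*} [Ring R] [Algebra ℂ R] {S : Set R} {a : R}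
    (ha : a ∈ Algebra.adjoin ℂ S) : ∃ c : ℂ, a - c • 1 ∈ NonUnitalAlgebra.adjoin ℂ S := by
  induction ha using Algebra.adjoin_induction with
  | mem a ha => exact ⟨0, by simpa using NonUnitalAlgebra.subset_adjoin ℂ ha⟩
  | algebraMap c => exact ⟨c, by simp [Algebra.algebraMap_eq_smul_one]⟩
  | add a b _ _ ha hb =>
    obtain ⟨c, hc⟩ := ha
    obtain ⟨d, hd⟩ := hb
    refine ⟨c + d, ?_⟩
    rw [add_smul, add_sub_add_comm]
    exact add_mem hc hd
  | mul a b _ _ ha hb =>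
    obtain ⟨c, hc⟩ := ha
    obtain ⟨d, hd⟩ := hb
    refine ⟨c * d, ?_⟩
    have e : a * b - (c * d) • 1 =
        (a - c • 1) * (b - d • 1) + c • (b - d • 1) + d • (a - c • 1) := by
      simp only [sub_mul, mul_sub, smul_mul_assoc, mul_smul_comm, one_mul, mul_one, smul_sub,
        smul_smul, mul_comm d c]
      abel
    rw [e]
    exact add_mem (add_mem (mul_mem hc hd) (SMulMemClass.smul_mem c hd))
      (SMulMemClass.smul_mem d hc)

/-- The unital closure is the non-unital one plus the scalars. -/
theorem mem_vN_iff_exists {S : Set A.toStarSubalgebra} {a : A.toStarSubalgebra} :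
    a ∈ vN S ↔ ∃ c : ℂ, a - c • 1 ∈ wStar S := by
  constructor
  · intro ha
    let W : Submodule ℂ (H →WOT[ℂ] H) :=
      ((NonUnitalAlgebra.adjoin ℂ S).map (toWOT A)).topologicalClosure.toSubmodule
    have hW : IsClosed (W : Set (H →WOT[ℂ] H)) := isClosed_closure
    -- A closed subspace plus a finite-dimensional one is closed.
    have hcl : IsClosed ((W ⊔ Submodule.span ℂ {1} : Submodule ℂ (H →WOT[ℂ] H)) :
        Set (H →WOT[ℂ] H)) := Submodule.isClosed_sup_finiteDimensional W _ hW
    have h1 : toWOT A a ∈ W ⊔ Submodule.span ℂ {1} := by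
      refine closure_minimal ?_ hcl (mem_vN_iff.1 ha)
      rintro _ ⟨b, hb, rfl⟩
      obtain ⟨c, hc⟩ := exists_sub_mem_adjoin hb
      refine Submodule.mem_sup.2 ⟨toWOT A (b - c • 1), subset_closure ⟨_, hc, rfl⟩, c • 1,
        Submodule.smul_mem _ _ (Submodule.mem_span_singleton_self 1), ?_⟩
      rw [map_sub, map_smul, map_one, sub_add_cancel]
    obtain ⟨w, hw, v, hv, hwv⟩ := Submodule.mem_sup.1 h1
    obtain ⟨c, rfl⟩ := Submodule.mem_span_singleton.1 hv
    refine ⟨c, ?_⟩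
    have : toWOT A (a - c • 1) = w := by
      rw [map_sub, map_smul, map_one, ← hwv, add_sub_cancel_right]
    change toWOT A (a - c • 1) ∈ W
    rwa [this]
  · rintro ⟨c, hc⟩
    have h1 : a - c • 1 ∈ vN S :=
      closure_mono (Set.image_mono (NonUnitalAlgebra.adjoin_le_algebra_adjoin ℂ S)) hc
    rw [← sub_add_cancel a (c • 1)]
    exact add_mem h1 (Subalgebra.smul_mem _ (one_mem _) c)

/-- The words in a selfadjoint family determine the generated non-unital algebra. -/
theorem adjoin_subset_of_words {R : Type*} [Ring R] [Algebra ℂ R] (x : ℕ → R) (J : Set ℕ)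
    (C : Submodule ℂ R)
    (hC : ∀ w : List ℕ, w ≠ [] → (∀ i ∈ w, i ∈ J) → (w.map x).prod ∈ C) :
    (NonUnitalAlgebra.adjoin ℂ (x '' J) : Set R) ⊆ C := by
  change (NonUnitalAlgebra.adjoin ℂ (x '' J)).toSubmodule ≤ C
  rw [NonUnitalAlgebra.adjoin_eq_span, Submodule.span_le]
  intro a ha
  suffices h : ∃ w : List ℕ, w ≠ [] ∧ (∀ i ∈ w, i ∈ J) ∧ (w.map x).prod = a by
    obtain ⟨w, h1, h2, rfl⟩ := h
    exact hC w h1 h2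
  induction ha using Subsemigroup.closure_induction with
  | mem a ha =>
    obtain ⟨i, hi, rfl⟩ := ha
    exact ⟨[i], by simp, by simpa using hi, by simp⟩
  | mul a b _ _ iha ihb =>
    obtain ⟨w, h1, h2, rfl⟩ := iha
    obtain ⟨v, h3, h4, rfl⟩ := ihb
    refine ⟨w ++ v, by simp [h1], ?_, by simp⟩
    intro i hi
    rcases List.mem_append.1 hi with hi | hi
    exacts [h2 i hi, h4 i hi]

/-- A subspace which is closed under bounded limits in the weak operator topology and contains
all words in a selfadjoint family contains the non-unital algebra which the family generates. -/
theorem wStar_le_of_words (x : ℕ → A.toStarSubalgebra) (hx : ∀ i, IsSelfAdjoint (x i))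
    (J : Set ℕ) (C : Submodule ℂ A.toStarSubalgebra)
    (hC : ∀ w : List ℕ, w ≠ [] → (∀ i ∈ w, i ∈ J) → (w.map x).prod ∈ C)
    (hlim : ∀ (l : Filter A.toStarSubalgebra) [NeBot l] (r : ℝ) (a : A.toStarSubalgebra),
      (∀ᶠ b in l, b ∈ C ∧ ‖b‖ ≤ r) → WTendsto l a → a ∈ C) {a : A.toStarSubalgebra}
    (ha : a ∈ wStar (x '' J)) : a ∈ C := by
  have hstar : ∀ b ∈ NonUnitalAlgebra.adjoin ℂ (x '' J),
      star b ∈ NonUnitalAlgebra.adjoin ℂ (x '' J) := by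
    intro b hb
    induction hb using NonUnitalAlgebra.adjoin_induction with
    | mem b hb =>
      have hb' := hb
      obtain ⟨i, _, rfl⟩ := hb
      rw [(hx i).star_eq]
      exact NonUnitalAlgebra.subset_adjoin ℂ hb'
    | add b c _ _ hb hc => rw [star_add]; exact add_mem hb hc
    | zero => rw [star_zero]; exact zero_mem _
    | mul b c _ _ hb hc => rw [star_mul]; exact mul_mem hc hb
    | smul c b _ hb => rw [star_smul]; exact SMulMemClass.smul_mem _ hb
  let M : NonUnitalStarSubalgebra ℂ A.toStarSubalgebra :=
    { NonUnitalAlgebra.adjoin ℂ (x '' J) with star_mem' := fun {b} hb => hstar b hb }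
  refine mem_of_mem_closure_WOT (A.toStarSubalgebra.subtype) M C
    (adjoin_subset_of_words x J C hC) ?_ ?_ ha
  -- Norm convergence is weak convergence, with norms eventually below `‖b‖ + 1`.
  · refine isClosed_of_closure_subset fun b hb => ?_
    have : NeBot (𝓝[(C : Set A.toStarSubalgebra)] b) := mem_closure_iff_nhdsWithin_neBot.1 hb
    refine hlim (𝓝[(C : Set A.toStarSubalgebra)] b) (‖b‖ + 1) b ?_
      (wTendsto_of_norm nhdsWithin_le_nhds)
    refine eventually_mem_nhdsWithin.and (eventually_nhdsWithin_of_eventually_nhds ?_)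
    exact (continuous_norm.tendsto b).eventually_le_const (by linarith)
  · intro c r b hbC hbr hb
    classical
    refine hlim (Filter.map b atTop) r c
      (eventually_map.2 (.of_forall fun i => ⟨hbC i, hbr i⟩)) fun y z => ?_
    rw [tendsto_map'_iff]
    exact tendsto_const_nhds.inner (hb z)

end WeakOperator

/-! ### The character of the unital closure -/

section Character

open Filter Topology

attribute [local instance] isClosed_vonNeumann

variable {H : Type*} [NormedAddCommGroup H] [InnerProductSpace ℂ H] [CompleteSpace H]
  {A : VonNeumannAlgebra H}

/-- If the unit is not in the non-unital closure, the latter is the kernel of a character. -/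
theorem exists_character {S : Set A.toStarSubalgebra} (hgen : vN S = ⊤)
    (hunit : (1 : A.toStarSubalgebra) ∉ wStar S) :
    ∃ χ : A.toStarSubalgebra →ₐ[ℂ] ℂ, ∀ a, a ∈ wStar S ↔ χ a = 0 := by
  have hex : ∀ a : A.toStarSubalgebra, ∃ c : ℂ, a - c • 1 ∈ wStar S := fun a =>
    mem_vN_iff_exists.1 (hgen ▸ Algebra.mem_top)
  -- Two different scalars would put a nonzero multiple of `1` into the non-unital closure.
  have huniq : ∀ (a : A.toStarSubalgebra) (c d : ℂ), a - c • 1 ∈ wStar S → a - d • 1 ∈ wStar S →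
      c = d := by
    intro a c d hc hd
    by_contra hne
    have h1 : (d - c) • (1 : A.toStarSubalgebra) ∈ wStar S := by
      have := sub_mem hc hd
      rwa [sub_sub_sub_cancel_left, ← sub_smul] at this
    have h2 := SMulMemClass.smul_mem (d - c)⁻¹ h1
    rw [inv_smul_smul₀ (sub_ne_zero.2 (Ne.symm hne))] at h2
    exact hunit h2
  choose f hf using hex
  let F : A.toStarSubalgebra →ₗ[ℂ] ℂ :=
    { toFun := f
      map_add' := fun a b => huniq (a + b) _ _ (hf _) (by
        rw [add_smul, add_sub_add_comm]; exact add_mem (hf a) (hf b))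
      map_smul' := fun c a => huniq (c • a) _ _ (hf _) (by
        rw [RingHom.id_apply, smul_eq_mul, mul_smul, ← smul_sub]
        exact SMulMemClass.smul_mem c (hf a)) }
  refine ⟨AlgHom.ofLinearMap F (huniq 1 _ _ (hf _) (by simp)) fun a b =>
    huniq (a * b) _ _ (hf _) ?_, fun a => ?_⟩
  · change a * b - (f a * f b) • 1 ∈ _
    have e : a * b - (f a * f b) • 1 =
        (a - f a • 1) * (b - f b • 1) + f a • (b - f b • 1) + f b • (a - f a • 1) := by
      simp only [sub_mul, mul_sub, smul_mul_assoc, mul_smul_comm, one_mul, mul_one, smul_sub,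
        smul_smul, mul_comm (f b) (f a)]
      abel
    rw [e]
    exact add_mem (add_mem (mul_mem (hf a) (hf b)) (SMulMemClass.smul_mem _ (hf b)))
      (SMulMemClass.smul_mem _ (hf a))
  · change a ∈ wStar S ↔ f a = 0
    constructor
    · intro ha
      exact huniq a _ _ (hf a) (by simpa using ha)
    · intro ha
      simpa [ha] using hf a

/-- The values of `χ` on a bounded set have a limit `c` along any ultrafilter. The elements `b -
χ(b) 1` stay in the weakly closed kernel, so `a - c 1` lies there too. -/
theorem tendsto_character {S : Set A.toStarSubalgebra} {χ : A.toStarSubalgebra →ₐ[ℂ] ℂ}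
    (hχ : ∀ a, a ∈ wStar S ↔ χ a = 0) {l : Filter A.toStarSubalgebra} {r : ℝ}
    (hl : ∀ᶠ b in l, ‖b‖ ≤ r) {a : A.toStarSubalgebra} (h : WTendsto l a) :
    Tendsto χ l (𝓝 (χ a)) := by
  rw [tendsto_iff_ultrafilter]
  intro u hu
  have hub : ∀ᶠ b in (u : Filter A.toStarSubalgebra), ‖b‖ ≤ r := hu hl
  obtain ⟨c, -, hc⟩ := (isCompact_closedBall (0 : ℂ) (r * ‖(1 : A.toStarSubalgebra)‖)).ultrafilter_le_nhds
    (u.map χ) (by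
      rw [le_principal_iff]
      change ∀ᶠ b in (u : Filter A.toStarSubalgebra), _
      filter_upwards [hub] with b hb
      rw [mem_closedBall_zero_iff]
      refine (AlgHom.norm_apply_le_self_mul_norm_one χ b).trans ?_
      gcongr)
  have hc' : Tendsto χ (u : Filter A.toStarSubalgebra) (𝓝 c) := hc
  have hmem : a - c • 1 ∈ wStar S := by
    refine ((h.mono hu).sub_smul_one hc').mem_wStar ?_
    rw [eventually_map]
    refine .of_forall fun b => (hχ _).2 ?_
    simp
  have : χ a = c := by
    have := (hχ _).1 hmem
    simpa [sub_eq_zero] using this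
  rwa [this]

/-- Each `n` gives its own scalar part. The scalars coincide because a nonzero difference would
place `1` in the closure generated by the whole sequence. -/
theorem mem_unitalTail_iff_exists {x : ℕ → A.toStarSubalgebra}
    (hunit : (1 : A.toStarSubalgebra) ∉ wStar (Set.range x)) (a : A.toStarSubalgebra) :
    a ∈ unitalTail x ↔ ∃ t ∈ nonunitalTail x, ∃ c : ℂ, a = t + c • 1 := by
  have hle : ∀ n, wStar (x '' Set.Ici n) ≤ wStar (Set.range x) := fun n =>
    wStar_mono (Set.image_subset_range _ _)
  have htail : ∀ b, b ∈ nonunitalTail x ↔ ∀ n, b ∈ wStar (x '' Set.Ici n) := fun b => by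
    rw [nonunitalTail, NonUnitalAlgebra.mem_iInf]
  rw [unitalTail, Algebra.mem_iInf]
  constructor
  · intro h
    choose c hc using fun n => mem_vN_iff_exists.1 (h n)
    have hcc : ∀ n, c n = c 0 := by
      intro n
      by_contra hne
      have h1 := sub_mem (hle 0 (hc 0)) (hle n (hc n))
      rw [sub_sub_sub_cancel_left, ← sub_smul] at h1
      have h2 := SMulMemClass.smul_mem (c n - c 0)⁻¹ h1
      rw [inv_smul_smul₀ (sub_ne_zero.2 hne)] at h2
      exact hunit h2
    refine ⟨a - c 0 • 1, (htail _).2 fun n => ?_, c 0, by simp⟩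
    rw [← hcc n]
    exact hc n
  · rintro ⟨t, ht, c, rfl⟩ n
    exact mem_vN_iff_exists.2 ⟨c, by simpa using (htail t).1 ht n⟩

end Character

/-! ### The GNS representation -/

section GNS

universe u

/-- The cyclic representation associated with a positive functional on a unital C*-algebra. -/
theorem exists_gns {D : Type u} [CStarAlgebra D] (φ : D →ₗ[ℂ] ℂ)
    (hφ : ∀ a, 0 ≤ φ (a * star a)) :
    ∃ (K : Type u) (_ : NormedAddCommGroup K) (_ : InnerProductSpace ℂ K) (_ : CompleteSpace K)
      (π : D →⋆ₐ[ℂ] (K →L[ℂ] K)) (ξ : K),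
      (∀ a, φ a = inner ℂ ξ (π a ξ)) ∧ DenseRange fun a => π a ξ := by
  let _ : PartialOrder D := CStarAlgebra.spectralOrder D
  have : StarOrderedRing D := CStarAlgebra.spectralOrderedRing D
  let f : D →ₚ[ℂ] ℂ := PositiveLinearMap.mk₀ φ fun a ha => by
    obtain ⟨b, rfl⟩ := CStarAlgebra.nonneg_iff_eq_mul_star_self.1 ha
    exact hφ b
  have hvec : ∀ a : D, f.gnsStarAlgHom a (f.toPreGNS 1 : f.PreGNS) = (f.toPreGNS a : f.PreGNS) := by
    intro a
    change f.gnsNonUnitalStarAlgHom a _ = _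
    rw [PositiveLinearMap.gnsNonUnitalStarAlgHom_apply_coe,
      PositiveLinearMap.leftMulMapPreGNS_apply]
    simp
  refine ⟨f.GNS, inferInstance, inferInstance, inferInstance, f.gnsStarAlgHom,
    (f.toPreGNS 1 : f.PreGNS), fun a => ?_, ?_⟩
  · rw [hvec, UniformSpace.Completion.inner_coe, PositiveLinearMap.preGNS_inner_def]
    simp
    rfl
  · simp only [hvec]
    exact UniformSpace.Completion.denseRange_coe.comp f.toPreGNS.surjective.denseRange
      (UniformSpace.Completion.continuous_coe _)

end GNS

/-! ### Cyclic representations of normal states -/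

section NormalRep

universe u

open Filter Topology

attribute [local instance] isClosed_vonNeumann

variable {H : Type*} [NormedAddCommGroup H] [InnerProductSpace ℂ H] [CompleteSpace H]
  {A : VonNeumannAlgebra H} {K : Type*} [NormedAddCommGroup K] [InnerProductSpace ℂ K]
  [CompleteSpace K]

/-- A cyclic representation which implements the functional `φ` as a vector state. -/
structure IsCyclicRep (φ : A.toStarSubalgebra →ₗ[ℂ] ℂ)
    (π : A.toStarSubalgebra →⋆ₐ[ℂ] (K →L[ℂ] K)) (ξ : K) : Prop where
  apply_eq : ∀ a, φ a = inner ℂ ξ (π a ξ)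
  dense : DenseRange fun a => π a ξ

theorem exists_isCyclicRep {H : Type u} [NormedAddCommGroup H] [InnerProductSpace ℂ H]
    [CompleteSpace H] {A : VonNeumannAlgebra H} (φ : A.toStarSubalgebra →ₗ[ℂ] ℂ)
    (hφ : ∀ a, 0 ≤ φ (a * star a)) :
    ∃ (K : Type u) (_ : NormedAddCommGroup K) (_ : InnerProductSpace ℂ K) (_ : CompleteSpace K)
      (π : A.toStarSubalgebra →⋆ₐ[ℂ] (K →L[ℂ] K)) (ξ : K), IsCyclicRep φ π ξ := by
  obtain ⟨K, _, _, _, π, ξ, h⟩ := exists_gns φ hφ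
  exact ⟨K, _, _, _, π, ξ, h.1, h.2⟩

variable {φ : A.toStarSubalgebra →ₗ[ℂ] ℂ} {π : A.toStarSubalgebra →⋆ₐ[ℂ] (K →L[ℂ] K)} {ξ : K}

theorem inner_rep_star (π : A.toStarSubalgebra →⋆ₐ[ℂ] (K →L[ℂ] K)) (a : A.toStarSubalgebra)
    (y z : K) : inner ℂ y (π (star a) z) = inner ℂ (π a y) z := by
  rw [map_star, ContinuousLinearMap.star_eq_adjoint, ContinuousLinearMap.adjoint_inner_right]

namespace IsCyclicRep

theorem inner_rep (h : IsCyclicRep φ π ξ) (b d c : A.toStarSubalgebra) :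
    inner ℂ (π b ξ) (π d (π c ξ)) = φ (star b * d * c) := by
  rw [h.apply_eq, map_mul, map_mul, mul_apply_eq_comp, mul_apply_eq_comp, inner_rep_star]

theorem norm_rep_apply_sub_le (π : A.toStarSubalgebra →⋆ₐ[ℂ] (K →L[ℂ] K))
    {r : ℝ} {a b : A.toStarSubalgebra} (hb : ‖b‖ ≤ r) (ζ : K) :
    ‖π b ζ - π a ζ‖ ≤ (r + ‖a‖) * ‖ζ‖ := by
  rw [← sub_apply, ← map_sub]
  refine ((π (b - a)).le_opNorm ζ).trans ?_
  gcongr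
  exact (NonUnitalStarAlgHom.norm_apply_le π _).trans ((norm_sub_le b a).trans (by gcongr))

/-- The cyclic representation of a normal functional is normal. -/
theorem tendsto_inner (h : IsCyclicRep φ π ξ) (hφ : IsNormalMap φ)
    {l : Filter A.toStarSubalgebra} {r : ℝ} (hl : ∀ᶠ b in l, ‖b‖ ≤ r) {a : A.toStarSubalgebra}
    (ha : WTendsto l a) (η ζ : K) :
    Tendsto (fun b => inner ℂ η (π b ζ)) l (𝓝 (inner ℂ η (π a ζ))) := by
  -- Between orbit vectors the coefficient is `φ (b* d c)`, and two-sided multiplication preserves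
  -- bounded weak convergence.
  have h1 : ∀ b c : A.toStarSubalgebra, Tendsto (fun d => inner ℂ (π b ξ) (π d (π c ξ))) l
      (𝓝 (inner ℂ (π b ξ) (π a (π c ξ)))) := by
    intro b c
    simp only [h.inner_rep]
    refine tendsto_map'_iff.1 (hφ.tendsto (r := ‖star b‖ * r * ‖c‖) ?_ (ha.mul_mul (star b) c))
    rw [eventually_map]
    filter_upwards [hl] with d hd
    refine (norm_mul_le _ _).trans ?_
    gcongr
    exact (norm_mul_le _ _).trans (by gcongr)
  have h2 : ∀ (η : K) (c : A.toStarSubalgebra),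
      Tendsto (fun d => inner ℂ η (π d (π c ξ) - π a (π c ξ))) l (𝓝 0) := by
    intro η c
    refine tendsto_inner_zero_of_mem_closure (S := Set.range fun b => π b ξ)
      (C := (r + ‖a‖) * ‖π c ξ‖) ?_ ?_ (h.dense η)
    · filter_upwards [hl] with d hd using norm_rep_apply_sub_le π hd _
    · rintro _ ⟨b, rfl⟩
      simpa only [inner_sub_right, tendsto_sub_nhds_zero_iff] using h1 b c
  -- The second vector is freed by passing to adjoints and using density once more.
  have h3 : Tendsto (fun d => inner ℂ ζ (π (star d) η - π (star a) η)) l (𝓝 0) := by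
    refine tendsto_inner_zero_of_mem_closure (S := Set.range fun b => π b ξ)
      (C := (r + ‖star a‖) * ‖η‖) ?_ ?_ (h.dense ζ)
    · filter_upwards [hl] with d hd
      exact norm_rep_apply_sub_le π (by rwa [norm_star]) _
    · rintro _ ⟨c, rfl⟩
      have := (Complex.continuous_conj.tendsto _).comp (h2 η c)
      rw [map_zero] at this
      refine this.congr fun d => ?_
      change starRingEnd ℂ _ = _
      rw [inner_conj_symm, inner_sub_left, inner_sub_right, inner_rep_star, inner_rep_star]
  have h4 := (Complex.continuous_conj.tendsto _).comp h3
  rw [map_zero] at h4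
  rw [← tendsto_sub_nhds_zero_iff]
  refine h4.congr fun d => ?_
  change starRingEnd ℂ _ = _
  rw [inner_conj_symm, inner_sub_left, ← inner_rep_star, ← inner_rep_star, star_star, star_star]

theorem injective (h : IsCyclicRep φ π ξ) (hφ : IsNondegenerated φ) : Function.Injective π := by
  rw [injective_iff_map_eq_zero]
  intro a ha
  refine hφ a fun b c => ?_
  rw [h.apply_eq, map_mul, map_mul, ha, mul_zero, zero_mul, zero_apply, inner_zero_right]

theorem norm_rep (h : IsCyclicRep φ π ξ) (hφ : IsNondegenerated φ) (a : A.toStarSubalgebra) :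
    ‖π a‖ = ‖a‖ := NonUnitalStarAlgHom.norm_map π (h.injective hφ) a

theorem rep_prod (π : A.toStarSubalgebra →⋆ₐ[ℂ] (K →L[ℂ] K)) (x : ℕ → A.toStarSubalgebra)
    (w : List ℕ) : π (w.map x).prod = (w.map fun i => π (x i)).prod := by
  rw [map_list_prod, List.map_map]
  rfl

/-- If a closed subspace contains the vectors given by all words, then it contains the vectors given
by the weakly closed algebra which they generate. -/
theorem rep_mem_of_words (h : IsCyclicRep φ π ξ) (hφ : IsNormalMap φ)
    {x : ℕ → A.toStarSubalgebra} (hx : ∀ i, IsSelfAdjoint (x i)) (Y : Submodule ℂ K)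
    (hY : IsClosed (Y : Set K)) (hw : ∀ w : List ℕ, w ≠ [] → (π (w.map x).prod) ξ ∈ Y)
    {a : A.toStarSubalgebra} (ha : a ∈ wStar (Set.range x)) : π a ξ ∈ Y := by
  let C : Submodule ℂ A.toStarSubalgebra :=
    { carrier := {a | π a ξ ∈ Y}
      zero_mem' := by simp
      add_mem' := fun {a b} ha hb => by
        simp only [Set.mem_ofPred_eq, map_add, add_apply] at *
        exact add_mem ha hb
      smul_mem' := fun c a ha => by
        simp only [Set.mem_ofPred_eq, map_smul, smul_apply] at *
        exact Y.smul_mem c ha }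
  rw [← Set.image_univ] at ha
  refine wStar_le_of_words x hx Set.univ C (fun w hw' _ => hw w hw') ?_ ha
  intro l _ r a hl ha
  change π a ξ ∈ Y
  have : CompleteSpace Y := hY.completeSpace_coe
  -- A closed subspace is a double orthogonal complement, hence weakly closed.
  rw [← Submodule.orthogonal_orthogonal Y, Submodule.mem_orthogonal]
  intro η hη
  have h1 := h.tendsto_inner hφ (hl.mono fun _ hb => hb.2) ha η ξ
  refine tendsto_nhds_unique h1 (tendsto_const_nhds.congr' ?_)
  filter_upwards [hl] with b hb
  exact (Submodule.inner_left_of_mem_orthogonal hb.1 hη).symm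

theorem runInvariant (h : IsCyclicRep φ π ξ) (hφ : IsNormalMap φ)
    {x : ℕ → A.toStarSubalgebra} (hx : ∀ i, IsSelfAdjoint (x i)) (hgen : vN (Set.range x) = ⊤)
    (hR : ∀ w w' : List ℕ, RunEq w w' → φ (w.map x).prod = φ (w'.map x).prod) :
    RunInvariant (fun i => π (x i)) ξ where
  selfAdjoint i := by rw [IsSelfAdjoint, ← map_star, (hx i).star_eq]
  moment w w' hw := by
    have := hR w w' hw
    rwa [h.apply_eq, h.apply_eq, rep_prod, rep_prod] at this
  dense := by
    set Y := (Submodule.span ℂ (Set.range (wordVec (fun i => π (x i)) ξ))).topologicalClosure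
      with hYdef
    have hY : IsClosed (Y : Set K) := Submodule.isClosed_topologicalClosure _
    have hw : ∀ w, wordVec (fun i => π (x i)) ξ w ∈ Y := fun w =>
      Submodule.le_topologicalClosure _ (Submodule.subset_span ⟨w, rfl⟩)
    have hall : ∀ a, π a ξ ∈ Y := by
      intro a
      obtain ⟨c, hc⟩ := mem_vN_iff_exists.1 (hgen ▸ Algebra.mem_top : a ∈ vN (Set.range x))
      have h1 := h.rep_mem_of_words hφ hx Y hY (fun w _ => by rw [rep_prod]; exact hw w) hc
      have h2 : π a ξ = π (a - c • 1) ξ + c • ξ := by simp [sub_apply, smul_apply]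
      rw [h2]
      exact add_mem h1 (Y.smul_mem c (by simpa using hw []))
    rw [eq_top_iff]
    intro η _
    exact closure_minimal (Set.range_subset_iff.2 hall) hY (h.dense η)

end IsCyclicRep

end NormalRep

/-! ### Compression to the tail space -/

section Compression

open Filter Topology

attribute [local instance] isClosed_vonNeumann

variable {K : Type*} [NormedAddCommGroup K] [InnerProductSpace ℂ K]

theorem norm_linearCombination_eq {ι : Type*} {p q : ι → K}
    (hpq : ∀ i j, inner ℂ (p i) (p j) = inner ℂ (q i) (q j)) (c : ι →₀ ℂ) :
    ‖Finsupp.linearCombination ℂ p c‖ = ‖Finsupp.linearCombination ℂ q c‖ := by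
  rw [@norm_eq_sqrt_re_inner ℂ, @norm_eq_sqrt_re_inner ℂ]
  simp only [Finsupp.linearCombination_apply, Finsupp.sum, sum_inner, inner_sum, inner_smul_left,
    inner_smul_right, hpq]

theorem norm_prod_map_le {R : Type*} [NormedRing R] {y : ℕ → R} {r : ℝ} (hy : ∀ i, ‖y i‖ ≤ r)
    (w : List ℕ) : ‖(w.map y).prod‖ ≤ r ^ w.length * ‖(1 : R)‖ := by
  induction w with
  | nil => simp
  | cons i w ih =>
    have hr : 0 ≤ r := (norm_nonneg _).trans (hy i)
    rw [List.map_cons, List.prod_cons, List.length_cons, pow_succ', mul_assoc]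
    exact (norm_mul_le _ _).trans (by gcongr; exact hy i)

theorem prod_map_mem_adjoin {R : Type*} [Ring R] [Algebra ℂ R] {y : ℕ → R} {J : Set ℕ}
    {w : List ℕ} (hw : w ≠ []) (hJ : ∀ i ∈ w, i ∈ J) :
    (w.map y).prod ∈ NonUnitalAlgebra.adjoin ℂ (y '' J) := by
  induction w with
  | nil => exact absurd rfl hw
  | cons i w ih =>
    have hi : y i ∈ NonUnitalAlgebra.adjoin ℂ (y '' J) :=
      NonUnitalAlgebra.subset_adjoin ℂ ⟨i, hJ i (by simp), rfl⟩
    rcases eq_or_ne w [] with rfl | hw'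
    · simpa using hi
    · rw [List.map_cons, List.prod_cons]
      exact mul_mem hi (ih hw' fun k hk => hJ k (by simp [hk]))

variable [CompleteSpace K]

/-- Exchanging the letters `i` and `j` in all words preserves inner products, and so acts
isometrically on the span while turning `X j` into `X i`. The resulting uniform bound provides weak
limits of shifted words. -/
theorem RunInvariant.norm_le {X : ℕ → K →L[ℂ] K} {ξ : K} (h : RunInvariant X ξ) (i j : ℕ) :
    ‖X j‖ ≤ ‖X i‖ := by
  refine (X j).opNorm_le_bound (norm_nonneg _) fun v => ?_
  have hcl : IsClosed {v | ‖X j v‖ ≤ ‖X i‖ * ‖v‖} :=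
    isClosed_le (by fun_prop) (by fun_prop)
  have hd : Dense (Submodule.span ℂ (Set.range (wordVec X ξ)) : Set K) :=
    Submodule.dense_iff_topologicalClosure_eq_top.2 h.dense
  refine closure_minimal ?_ hcl (hd v)
  intro v hv
  obtain ⟨c, rfl⟩ := Finsupp.mem_span_range_iff_exists_finsupp.1 hv
  change ‖X j (Finsupp.linearCombination ℂ (wordVec X ξ) c)‖ ≤
    ‖X i‖ * ‖Finsupp.linearCombination ℂ (wordVec X ξ) c‖
  have hs := (Equiv.swap i j).injective
  have e : ∀ (k : ℕ) (p : List ℕ → K), X k (Finsupp.linearCombination ℂ p c) =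
      Finsupp.linearCombination ℂ (fun w => X k (p w)) c := fun k p =>
    Finsupp.apply_linearCombination ℂ (X k : K →ₗ[ℂ] K) p c
  have h1 := norm_linearCombination_eq (p := wordVec X ξ)
    (q := fun w => wordVec X ξ (w.map (Equiv.swap i j)))
    (fun c b => h.inner_wordVec_map hs hs c b fun k _ l _ => hs.eq_iff.symm) c
  have h2 := norm_linearCombination_eq (p := fun w => X j (wordVec X ξ w))
    (q := fun w => X i (wordVec X ξ (w.map (Equiv.swap i j)))) (fun c b => by
      simp only [← wordVec_cons]
      rw [h.inner_wordVec_map hs hs (j :: c) (j :: b) fun k _ l _ => hs.eq_iff.symm]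
      simp) c
  rw [e, h2, h1, ← e]
  exact (X i).le_opNorm _

theorem norm_tailProj_mul_mul_le (X : ℕ → K →L[ℂ] K) (ξ : K) (a : K →L[ℂ] K) :
    ‖tailProj X ξ * a * tailProj X ξ‖ ≤ ‖a‖ := by
  have hQ : ‖tailProj X ξ‖ ≤ 1 := Submodule.starProjection_norm_le _
  calc ‖tailProj X ξ * a * tailProj X ξ‖ ≤ 1 * ‖a‖ * 1 := by
        refine (norm_mul_le _ _).trans ?_
        gcongr
        exact (norm_mul_le _ _).trans (by gcongr)
    _ = ‖a‖ := by rw [one_mul, mul_one]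

variable {H : Type*} [NormedAddCommGroup H] [InnerProductSpace ℂ H] [CompleteSpace H]
  {A : VonNeumannAlgebra H}
  {φ : A.toStarSubalgebra →ₗ[ℂ] ℂ} {π : A.toStarSubalgebra →⋆ₐ[ℂ] (K →L[ℂ] K)} {ξ : K}
  {x : ℕ → A.toStarSubalgebra}

theorem mem_nonunitalTail {a : A.toStarSubalgebra} :
    a ∈ nonunitalTail x ↔ ∀ n, a ∈ wStar (x '' Set.Ici n) := by
  rw [nonunitalTail, NonUnitalAlgebra.mem_iInf]

namespace IsCyclicRep

theorem tendsto_inner_tailProj (h : IsCyclicRep φ π ξ) (hφ : IsNormalMap φ)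
    {l : Filter A.toStarSubalgebra} {r : ℝ} (hl : ∀ᶠ b in l, ‖b‖ ≤ r) {a : A.toStarSubalgebra}
    (ha : WTendsto l a) (X : ℕ → K →L[ℂ] K) (η ζ : K) :
    Tendsto (fun b => inner ℂ η ((tailProj X ξ * π b * tailProj X ξ) ζ)) l
      (𝓝 (inner ℂ η ((tailProj X ξ * π a * tailProj X ξ) ζ))) := by
  simp only [mul_apply_eq_comp, ← inner_tailProj]
  exact h.tendsto_inner hφ hl ha _ _

/-- For given `b` and `c`, a tail element is reached from words with letters beyond both, and for
these the projections are invisible between the two vectors. -/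
theorem tailProj_rep_tailProj (h : IsCyclicRep φ π ξ) (hφ : IsNormalMap φ)
    (hx : ∀ i, IsSelfAdjoint (x i)) (hX : RunInvariant (fun i => π (x i)) ξ)
    {t : A.toStarSubalgebra} (ht : t ∈ nonunitalTail x) :
    tailProj (fun i => π (x i)) ξ * π t * tailProj (fun i => π (x i)) ξ = π t := by
  refine hX.ext_inner fun c b => ?_
  let C : Submodule ℂ A.toStarSubalgebra :=
    { carrier := {a | inner ℂ (wordVec (fun i => π (x i)) ξ c)
          ((tailProj (fun i => π (x i)) ξ * π a * tailProj (fun i => π (x i)) ξ)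
            (wordVec (fun i => π (x i)) ξ b)) =
        inner ℂ (wordVec (fun i => π (x i)) ξ c) (π a (wordVec (fun i => π (x i)) ξ b))}
      zero_mem' := by simp
      add_mem' := fun {a b} ha hb => by
        simp only [Set.mem_ofPred_eq, map_add, add_apply, mul_add, add_mul, inner_add_right] at *
        rw [ha, hb]
      smul_mem' := fun c a ha => by
        simp only [Set.mem_ofPred_eq, map_smul, smul_apply, mul_smul_comm, smul_mul_assoc,
          inner_smul_right] at *
        rw [ha] }
  refine wStar_le_of_words x hx (Set.Ici (c.sum + b.sum + 1)) C ?_ ?_ (mem_nonunitalTail.1 ht _)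
  · intro w hw hw'
    change inner ℂ _ _ = inner ℂ _ _
    rw [rep_prod]
    refine hX.inner_tailProj_word_tailProj hw ?_ ?_
    · intro i hi j hj
      have h1 : c.sum + b.sum + 1 ≤ i := hw' i (List.mem_of_mem_getLast? hi)
      have h2 := List.le_sum_of_mem (List.mem_of_mem_head? hj)
      omega
    · intro i hi j hj
      have h1 : c.sum + b.sum + 1 ≤ i := hw' i (List.mem_of_mem_head? hi)
      have h2 := List.le_sum_of_mem (List.mem_of_mem_head? hj)
      omega
  · intro l _ r a hl ha
    have hl' := hl.mono fun _ hb => hb.2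
    exact tendsto_nhds_unique_of_eventuallyEq (h.tendsto_inner_tailProj hφ hl' ha _ _ _)
      (h.tendsto_inner hφ hl' ha _ _) (hl.mono fun _ hb => hb.1)

/-- All shifts of `w` have the same compression by the tail projection, and against given word
vectors a far shift equals its compression. A weak cluster point of the shifts is therefore
represented by that compression, and it lies in every tail. -/
theorem exists_word_compression (h : IsCyclicRep φ π ξ) (hφ : IsNormalMap φ)
    (hφ' : IsNondegenerated φ) (hX : RunInvariant (fun i => π (x i)) ξ) {w : List ℕ}
    (hw : w ≠ []) :
    ∃ e ∈ nonunitalTail x, π e = tailProj (fun i => π (x i)) ξ * π (w.map x).prod *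
      tailProj (fun i => π (x i)) ξ := by
  let s : ℕ → A.toStarSubalgebra := fun M => ((w.map (· + M)).map x).prod
  have hnorm : ∀ i, ‖x i‖ ≤ ‖x 0‖ := fun i => by
    rw [← h.norm_rep hφ', ← h.norm_rep hφ' (x 0)]
    exact hX.norm_le 0 i
  have hbd : ∀ᶠ b in ((hyperfilter ℕ).map s : Filter A.toStarSubalgebra),
      ‖b‖ ≤ ‖x 0‖ ^ w.length * ‖(1 : A.toStarSubalgebra)‖ :=
    eventually_map.2 (.of_forall fun M => by
      have := norm_prod_map_le hnorm (w.map (· + M))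
      rwa [List.length_map] at this)
  obtain ⟨e, he⟩ := exists_wTendsto ((hyperfilter ℕ).map s) hbd
  refine ⟨e, mem_nonunitalTail.2 fun n => he.mem_wStar ?_, hX.ext_inner fun c b => ?_⟩
  · rw [Ultrafilter.coe_map, eventually_map]
    filter_upwards [Nat.hyperfilter_le_atTop (eventually_ge_atTop n)] with M hM
    refine subset_wStar _ (prod_map_mem_adjoin (by simpa using hw) fun i hi => ?_)
    obtain ⟨k, -, rfl⟩ := List.mem_map.1 hi
    exact le_add_left hM
  · have h1 := h.tendsto_inner hφ hbd he (wordVec (fun i => π (x i)) ξ c)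
      (wordVec (fun i => π (x i)) ξ b)
    rw [Ultrafilter.coe_map, tendsto_map'_iff] at h1
    refine tendsto_nhds_unique h1 (tendsto_const_nhds.congr' ?_)
    filter_upwards [Nat.hyperfilter_le_atTop (eventually_gt_atTop (c.sum + b.sum))] with M hM
    change _ = inner ℂ _ (π (s M) _)
    rw [rep_prod, hX.tailProj_word_tailProj_map (add_left_injective M) w, rep_prod]
    refine hX.inner_tailProj_word_tailProj (by simpa using hw) ?_ ?_
    · intro i hi j hj
      obtain ⟨k, -, rfl⟩ := List.mem_map.1 (List.mem_of_mem_getLast? hi)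
      have h2 := List.le_sum_of_mem (List.mem_of_mem_head? hj)
      omega
    · intro i hi j hj
      obtain ⟨k, -, rfl⟩ := List.mem_map.1 (List.mem_of_mem_head? hi)
      have h2 := List.le_sum_of_mem (List.mem_of_mem_head? hj)
      omega

/-- The elements with a compression in the tail algebra are closed under bounded weak limits: `π` is
isometric and compression is contractive, so the corresponding tail elements stay bounded and
cluster weakly. -/
theorem exists_compression (h : IsCyclicRep φ π ξ) (hφ : IsNormalMap φ)
    (hφ' : IsNondegenerated φ) (hx : ∀ i, IsSelfAdjoint (x i))
    (hX : RunInvariant (fun i => π (x i)) ξ) {a : A.toStarSubalgebra}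
    (ha : a ∈ wStar (Set.range x)) :
    ∃ e ∈ nonunitalTail x, π e = tailProj (fun i => π (x i)) ξ * π a *
      tailProj (fun i => π (x i)) ξ := by
  let C : Submodule ℂ A.toStarSubalgebra :=
    { carrier := {a | ∃ e ∈ nonunitalTail x, π e = tailProj (fun i => π (x i)) ξ * π a *
        tailProj (fun i => π (x i)) ξ}
      zero_mem' := ⟨0, zero_mem _, by simp⟩
      add_mem' := by
        rintro a b ⟨d, hd, hd'⟩ ⟨e, he, he'⟩
        exact ⟨d + e, add_mem hd he, by rw [map_add, hd', he', map_add, mul_add, add_mul]⟩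
      smul_mem' := by
        rintro c a ⟨d, hd, hd'⟩
        exact ⟨c • d, SMulMemClass.smul_mem c hd, by
          rw [map_smul, hd', map_smul, mul_smul_comm, smul_mul_assoc]⟩ }
  rw [← Set.image_univ] at ha
  refine wStar_le_of_words x hx Set.univ C
    (fun w hw _ => h.exists_word_compression hφ hφ' hX hw) ?_ ha
  intro l _ r a hl ha
  let u := Ultrafilter.of l
  have hul : (u : Filter A.toStarSubalgebra) ≤ l := Ultrafilter.of_le l
  -- The ultrafilter lives on the whole algebra, so a value is also needed off `C`; the default `0`
  -- there has no effect on the limit.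
  have hC : ∀ b : A.toStarSubalgebra, ∃ e, b ∈ C → e ∈ nonunitalTail x ∧
      π e = tailProj (fun i => π (x i)) ξ * π b * tailProj (fun i => π (x i)) ξ := by
    intro b
    by_cases hb : b ∈ C
    · obtain ⟨e, h1, h2⟩ := hb
      exact ⟨e, fun _ => ⟨h1, h2⟩⟩
    · exact ⟨0, fun hb' => absurd hb' hb⟩
  choose e he using hC
  have hbd : ∀ᶠ b in (u.map e : Filter A.toStarSubalgebra), ‖b‖ ≤ r := by
    rw [Ultrafilter.coe_map, eventually_map]
    filter_upwards [hul hl] with b hb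
    rw [← h.norm_rep hφ', (he b hb.1).2]
    refine (norm_tailProj_mul_mul_le _ _ _).trans ?_
    rw [h.norm_rep hφ']
    exact hb.2
  obtain ⟨t, ht⟩ := exists_wTendsto (u.map e) hbd
  refine ⟨t, mem_nonunitalTail.2 fun n => ht.mem_wStar ?_, hX.ext_inner fun c b => ?_⟩
  · rw [Ultrafilter.coe_map, eventually_map]
    filter_upwards [hul hl] with b hb using mem_nonunitalTail.1 (he b hb.1).1 n
  · have h1 := h.tendsto_inner hφ hbd ht (wordVec (fun i => π (x i)) ξ c)
      (wordVec (fun i => π (x i)) ξ b)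
    rw [Ultrafilter.coe_map, tendsto_map'_iff] at h1
    have h2 := h.tendsto_inner_tailProj hφ (hul (hl.mono fun _ hb => hb.2)) (ha.mono hul)
      (fun i => π (x i)) (wordVec (fun i => π (x i)) ξ c) (wordVec (fun i => π (x i)) ξ b)
    refine tendsto_nhds_unique_of_eventuallyEq h1 h2 ?_
    filter_upwards [hul hl] with b hb
    rw [Function.comp_apply, (he b hb.1).2]

end IsCyclicRep

end Compression

/-! ### Conditional expectations given by a compression -/

section AlgebraicCompression

/-- A `Q` is inserted at each junction and split as `Q * Q`. -/
theorem mul_prod_mul_of_isChain {R : Type*} [Ring R] {Q : R} (hQ : Q * Q = Q) {l : List R}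
    (hl : l ≠ []) (hc : l.IsChain fun a b => a * b = a * Q * b) :
    Q * l.prod * Q = (l.map fun a => Q * a * Q).prod := by
  induction l with
  | nil => exact absurd rfl hl
  | cons a l ih =>
    cases l with
    | nil => simp
    | cons b l =>
      rw [List.isChain_cons_cons] at hc
      have e : a * (b :: l).prod = a * Q * (b :: l).prod := by
        rw [List.prod_cons, ← mul_assoc, hc.1, mul_assoc]
      have e' : Q * (a * Q * (b :: l).prod) * Q = Q * a * (Q * Q) * (b :: l).prod * Q := by
        rw [hQ]
        simp only [mul_assoc]
      rw [List.map_cons, List.prod_cons (l := List.map _ _), ← ih (by simp) hc.2,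
        List.prod_cons (l := b :: l), e, e']
      simp only [mul_assoc]

variable {𝒜 : Type*} [Ring 𝒜] [Algebra ℂ 𝒜] {ℬ : Subalgebra ℂ 𝒜}

/-- The letter of `ℬ⟨X⟩` given by an element of `ℬ`. -/
def BPoly.letter (b : ℬ) : BPoly ℬ :=
  RingQuot.mkAlgHom ℂ (BPolyRel ℬ) (FreeAlgebra.ι ℂ (some b))

@[simp]
theorem BPoly.eval_letter (x : 𝒜) (b : ℬ) : BPoly.eval ℬ x (BPoly.letter b) = b := by
  simp [BPoly.eval, BPoly.letter]

theorem BPoly.induction_left {P : BPoly ℬ → Prop} (one : P 1)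
    (add : ∀ p q, P p → P q → P (p + q)) (smul : ∀ (c : ℂ) p, P p → P (c • p))
    (X : ∀ p, P p → P (BPoly.X ℬ * p)) (letter : ∀ b p, P p → P (BPoly.letter b * p))
    (p : BPoly ℬ) : P p := by
  obtain ⟨f, rfl⟩ := RingQuot.mkAlgHom_surjective ℂ (BPolyRel ℬ) p
  suffices h : ∀ q, P q → P (RingQuot.mkAlgHom ℂ (BPolyRel ℬ) f * q) by
    simpa using h 1 one
  induction f using FreeAlgebra.induction with
  | grade0 c =>
    intro q hq
    rw [AlgHom.commutes, ← Algebra.smul_def]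
    exact smul c q hq
  | grade1 o =>
    intro q hq
    cases o with
    | none => exact X q hq
    | some b => exact letter b q hq
  | mul f g hf hg =>
    intro q hq
    rw [map_mul, mul_assoc]
    exact hf _ (hg _ hq)
  | add f g hf hg =>
    intro q hq
    rw [map_add, add_mul]
    exact add _ _ (hf q hq) (hg q hq)

variable {R : Type*} [Ring R] [Algebra ℂ R]

/-- In a faithful representation `π`, the map `E` is the compression by an idempotent `Q`, with
the scalars given by a character `χ` on the complement of `Q`. -/
structure IsCompression (π : 𝒜 →ₐ[ℂ] R) (χ : 𝒜 →ₐ[ℂ] ℂ) (Q : R) (E : 𝒜 →ₗ[ℂ] ℬ) : Prop where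
  injective : Function.Injective π
  idem : Q * Q = Q
  map_coe : ∀ b : ℬ, π b = Q * π b * Q + χ b • (1 - Q)
  map_apply : ∀ a, π (E a) = Q * π a * Q + χ a • (1 - Q)

namespace IsCompression

variable {π : 𝒜 →ₐ[ℂ] R} {χ : 𝒜 →ₐ[ℂ] ℂ} {Q : R} {E : 𝒜 →ₗ[ℂ] ℬ}

theorem exists_map_coe (h : IsCompression π χ Q E) (b : ℬ) :
    ∃ (t : R) (c : ℂ), π b = Q * t * Q + c • 1 :=
  ⟨π b - χ b • 1, χ b, by
    conv_lhs => rw [h.map_coe b]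
    rw [mul_sub, sub_mul, mul_smul_comm, smul_mul_assoc, mul_one, h.idem, smul_sub]
    abel⟩

theorem map_coe_mul (h : IsCompression π χ Q E) (b : ℬ) : π b * Q = Q * π b * Q := by
  conv_lhs => rw [h.map_coe b]
  rw [add_mul, smul_mul_assoc, sub_mul, one_mul, h.idem, sub_self, smul_zero, add_zero, mul_assoc,
    h.idem]

theorem mul_map_coe (h : IsCompression π χ Q E) (b : ℬ) : Q * π b = Q * π b * Q := by
  conv_lhs => rw [h.map_coe b]
  rw [mul_add, mul_smul_comm, mul_sub, mul_one, h.idem, sub_self, smul_zero, add_zero, ← mul_assoc,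
    ← mul_assoc, h.idem]

theorem apply_eq_apply_iff (h : IsCompression π χ Q E) {a b : 𝒜}
    (h1 : Q * π a * Q = Q * π b * Q) (h2 : χ a = χ b) : E a = E b :=
  Subtype.ext (h.injective (by rw [h.map_apply, h.map_apply, h1, h2]))

theorem apply_coe (h : IsCompression π χ Q E) (b : ℬ) : E b = b :=
  Subtype.ext (h.injective (by rw [h.map_apply, ← h.map_coe]))

theorem mul_mul_self (h : IsCompression π χ Q E) (a b : R) (α β : ℂ) :
    (Q * a * Q + α • (1 - Q)) * (Q * b * Q + β • (1 - Q)) =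
      Q * (a * Q * b) * Q + (α * β) • (1 - Q) := by
  have h1 : ∀ z, Q * (Q * z) = Q * z := fun z => by rw [← mul_assoc, h.idem]
  have h2 : (1 - Q) * Q = 0 := by rw [sub_mul, one_mul, h.idem, sub_self]
  have h3 : ∀ z, (1 - Q) * (Q * z) = 0 := fun z => by rw [← mul_assoc, h2, zero_mul]
  have h4 : Q * (1 - Q) = 0 := by rw [mul_sub, mul_one, h.idem, sub_self]
  have h5 : (1 - Q) * (1 - Q) = 1 - Q := by rw [mul_sub, mul_one, h2, sub_zero]
  simp only [add_mul, mul_add, smul_mul_assoc, mul_smul_comm, mul_assoc, h1, h3, h4, h5, mul_zero,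
    smul_zero, add_zero, zero_add, smul_smul, mul_comm β α]

/-- Elements of `ℬ` are block diagonal for `Q` and `1 - Q` and scalar on the second block, so
compression respects multiplication by them on either side; `E` fixes each of them. -/
theorem isConditionalExpectation (h : IsCompression π χ Q E) : IsConditionalExpectation E where
  bimodule b₁ b₂ a := by
    refine Subtype.ext (h.injective ?_)
    rw [h.map_apply, Subalgebra.coe_mul, Subalgebra.coe_mul, map_mul, map_mul, map_mul, map_mul,
      map_mul, map_mul, h.map_apply]
    conv_rhs => rw [h.map_coe b₁, h.map_coe b₂, h.mul_mul_self, h.mul_mul_self]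
    congr 1
    have e : Q * (π b₁ * π a * π b₂) * Q = (Q * π b₁) * π a * (π b₂ * Q) := by
      simp only [mul_assoc]
    rw [e, h.mul_map_coe, h.map_coe_mul]
    simp only [mul_assoc]
  onto b := ⟨b, h.apply_coe b⟩

variable {I : Type*} {x : I → 𝒜}

theorem character_eval_eq (hx : ∀ i, χ (x i) = 0) (i j : I) (p : BPoly ℬ) :
    χ (BPoly.eval ℬ (x i) p) = χ (BPoly.eval ℬ (x j) p) := by
  induction p using BPoly.induction_left with
  | one => simp
  | add p q hp hq => simp [hp, hq]
  | smul c p hp => simp [hp]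
  | X p _ => simp [BPoly.eval_X, hx]
  | letter b p hp => simp [hp]

theorem identDistribOver (h : IsCompression π χ Q E) (hx : ∀ i, χ (x i) = 0)
    (hpow : ∀ i j k, Q * π (x i) ^ k * Q = Q * π (x j) ^ k * Q) : IdentDistribOver E x := by
  intro i j p
  refine h.apply_eq_apply_iff ?_ (character_eval_eq hx i j p)
  -- The leading power makes the induction close: a letter `X` raises `k`, while an element of `ℬ`,
  -- of the form `Q t Q + c`, splits off a compressed power.
  suffices hk : ∀ k, Q * π (x i) ^ k * π (BPoly.eval ℬ (x i) p) * Q =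
      Q * π (x j) ^ k * π (BPoly.eval ℬ (x j) p) * Q by simpa using hk 0
  induction p using BPoly.induction_left with
  | one => simpa using hpow i j
  | add p q hp hq =>
    intro k
    simp only [map_add, mul_add, add_mul, hp k, hq k]
  | smul c p hp =>
    intro k
    simp only [map_smul, mul_smul_comm, smul_mul_assoc, hp k]
  | X p hp =>
    intro k
    simpa only [map_mul, BPoly.eval_X, pow_succ, mul_assoc] using hp (k + 1)
  | letter b p hp =>
    intro k
    obtain ⟨t, c, htc⟩ := h.exists_map_coe b
    have e : ∀ l, Q * π (x l) ^ k * π (BPoly.eval ℬ (x l) (BPoly.letter b * p)) * Q =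
        (Q * π (x l) ^ k * Q) * t * (Q * π (x l) ^ 0 * π (BPoly.eval ℬ (x l) p) * Q) +
          c • (Q * π (x l) ^ k * π (BPoly.eval ℬ (x l) p) * Q) := by
      intro l
      rw [map_mul, map_mul, BPoly.eval_letter, htc]
      simp only [add_mul, mul_add, smul_mul_assoc, mul_smul_comm, one_mul, mul_one, pow_zero,
        mul_assoc]
    rw [e, e, hp 0, hp k, hpow i j]

/-- Elements of `ℬ` lie in `Q R Q` plus scalars, so left multiplication by them keeps an initial `Q`
or `x_i`, or else creates an initial `Q`. -/
theorem eval_mul_mem (h : IsCompression π χ Q E) (i : I) (p : BPoly ℬ) {m : R}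
    (hm : ∃ c d, m = Q * c + π (x i) * d) :
    ∃ c d, π (BPoly.eval ℬ (x i) p) * m = Q * c + π (x i) * d := by
  induction p using BPoly.induction_left with
  | one => simpa using hm
  | add p q hp hq =>
    obtain ⟨c, d, hp⟩ := hp
    obtain ⟨c', d', hq⟩ := hq
    exact ⟨c + c', d + d', by rw [map_add, map_add, add_mul, hp, hq, mul_add, mul_add]; abel⟩
  | smul r p hp =>
    obtain ⟨c, d, hp⟩ := hp
    exact ⟨r • c, r • d, by
      rw [map_smul, map_smul, smul_mul_assoc, hp, smul_add, mul_smul_comm, mul_smul_comm]⟩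
  | X p hp =>
    exact ⟨0, π (BPoly.eval ℬ (x i) p) * m, by
      rw [map_mul, map_mul, BPoly.eval_X, mul_assoc, mul_zero, zero_add]⟩
  | letter b p hp =>
    obtain ⟨c, d, hp⟩ := hp
    obtain ⟨t, r, htr⟩ := h.exists_map_coe b
    refine ⟨t * Q * (Q * c + π (x i) * d) + r • c, r • d, ?_⟩
    rw [map_mul, map_mul, BPoly.eval_letter, mul_assoc, hp, htr]
    simp only [add_mul, mul_add, smul_mul_assoc, mul_smul_comm, one_mul, mul_assoc]
    abel

theorem mul_eval_mem (h : IsCompression π χ Q E) (i : I) (p : BPoly ℬ) {m : R}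
    (hm : ∃ c d, m = c * Q + d * π (x i)) :
    ∃ c d, m * π (BPoly.eval ℬ (x i) p) = c * Q + d * π (x i) := by
  induction p using BPoly.induction_left generalizing m with
  | one => simpa using hm
  | add p q hp hq =>
    obtain ⟨c, d, hp⟩ := hp hm
    obtain ⟨c', d', hq⟩ := hq hm
    exact ⟨c + c', d + d', by rw [map_add, map_add, mul_add, hp, hq, add_mul, add_mul]; abel⟩
  | smul r p hp =>
    obtain ⟨c, d, hp⟩ := hp hm
    exact ⟨r • c, r • d, by
      rw [map_smul, map_smul, mul_smul_comm, hp, smul_add, smul_mul_assoc, smul_mul_assoc]⟩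
  | X p hp =>
    rw [map_mul, map_mul, BPoly.eval_X, ← mul_assoc]
    exact hp ⟨0, m, by rw [zero_mul, zero_add]⟩
  | letter b p hp =>
    rw [map_mul, map_mul, BPoly.eval_letter, ← mul_assoc]
    obtain ⟨c, d, rfl⟩ := hm
    obtain ⟨t, r, htr⟩ := h.exists_map_coe b
    refine hp ⟨(c * Q + d * π (x i)) * (Q * t) + r • c, r • d, ?_⟩
    rw [htr]
    simp only [add_mul, mul_add, smul_mul_assoc, mul_smul_comm, mul_one, smul_add, mul_assoc]
    abel

theorem eval_noConst (h : IsCompression π χ Q E) (hx : ∀ i, χ (x i) = 0) (i : I) {p : BPoly ℬ}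
    (hp : p ∈ BPoly.noConst ℬ) :
    χ (BPoly.eval ℬ (x i) p) = 0 ∧ (∃ c d, π (BPoly.eval ℬ (x i) p) = Q * c + π (x i) * d) ∧
      ∃ c d, π (BPoly.eval ℬ (x i) p) = c * Q + d * π (x i) := by
  induction hp using Submodule.span_induction with
  | mem p hp =>
    obtain ⟨f, g, rfl⟩ := hp
    refine ⟨by simp [BPoly.eval_X, hx], ?_, ?_⟩
    · simp only [map_mul, BPoly.eval_X, mul_assoc]
      exact h.eval_mul_mem i f ⟨0, _, by rw [mul_zero, zero_add]⟩
    · simp only [map_mul, BPoly.eval_X]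
      exact h.mul_eval_mem i g ⟨0, _, by rw [zero_mul, zero_add]⟩
  | zero => exact ⟨by simp, ⟨0, 0, by simp⟩, ⟨0, 0, by simp⟩⟩
  | add p q _ _ hp hq =>
    obtain ⟨h1, ⟨c, d, h2⟩, ⟨e, f, h3⟩⟩ := hp
    obtain ⟨h1', ⟨c', d', h2'⟩, ⟨e', f', h3'⟩⟩ := hq
    refine ⟨by rw [map_add, map_add, h1, h1', add_zero], ⟨c + c', d + d', ?_⟩,
      ⟨e + e', f + f', ?_⟩⟩
    · rw [map_add, map_add, h2, h2', mul_add, mul_add]; abel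
    · rw [map_add, map_add, h3, h3', add_mul, add_mul]; abel
  | smul r p _ hp =>
    obtain ⟨h1, ⟨c, d, h2⟩, ⟨e, f, h3⟩⟩ := hp
    refine ⟨by rw [map_smul, map_smul, h1, smul_zero], ⟨r • c, r • d, ?_⟩,
      ⟨r • e, r • f, ?_⟩⟩
    · rw [map_smul, map_smul, h2, smul_add, mul_smul_comm, mul_smul_comm]
    · rw [map_smul, map_smul, h3, smul_add, smul_mul_assoc, smul_mul_assoc]

/-- A polynomial without constant term begins and ends, in each summand, with `Q` or its own
variable. At a junction of different indices `Q` can be inserted: next to another `Q` by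
idempotence, between two variables by `hQ`. The character vanishes on every factor, so no `1 - Q`
part appears. -/
theorem booleanIndepOver (h : IsCompression π χ Q E) (hx : ∀ i, χ (x i) = 0)
    (hQ : ∀ i j, i ≠ j → π (x i) * Q * π (x j) = π (x i) * π (x j)) : BooleanIndepOver E x := by
  intro l hl hchain hp
  refine Subtype.ext (h.injective ?_)
  have hχ : χ (l.map fun q => BPoly.eval ℬ (x q.1) q.2).prod = 0 := by
    obtain ⟨q, l, rfl⟩ := List.exists_cons_of_ne_nil hl
    rw [List.map_cons, List.prod_cons, map_mul, (h.eval_noConst hx q.1 (hp q (by simp))).1,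
      zero_mul]
  have e : π ((l.map fun q => E (BPoly.eval ℬ (x q.1) q.2)).prod : ℬ) =
      (l.map fun q => π (E (BPoly.eval ℬ (x q.1) q.2))).prod := by
    change (π.comp ℬ.val) _ = _
    rw [map_list_prod, List.map_map]
    rfl
  have e' : (l.map fun q => π (E (BPoly.eval ℬ (x q.1) q.2))) =
      ((l.map fun q => π (BPoly.eval ℬ (x q.1) q.2)).map fun a => Q * a * Q) := by
    rw [List.map_map]
    refine List.map_congr_left fun q hq => ?_
    rw [h.map_apply, (h.eval_noConst hx q.1 (hp q hq)).1, zero_smul, add_zero]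
    rfl
  rw [h.map_apply, hχ, zero_smul, add_zero, e, e', ← mul_prod_mul_of_isChain h.idem (by simpa using hl),
    map_list_prod, List.map_map]
  · rfl
  · rw [List.isChain_map]
    refine hchain.imp_of_mem_imp fun q r hq hr hqr => ?_
    obtain ⟨-, -, a, b, h1⟩ := h.eval_noConst hx q.1 (hp q hq)
    obtain ⟨-, ⟨c, d, h2⟩, -⟩ := h.eval_noConst hx r.1 (hp r hr)
    rw [h1, h2]
    have h3 : ∀ z, Q * (Q * z) = Q * z := fun z => by rw [← mul_assoc, h.idem]
    have h4 : ∀ z, π (x q.1) * (Q * (π (x r.1) * z)) = π (x q.1) * (π (x r.1) * z) := fun z => by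
      rw [← mul_assoc, ← mul_assoc, hQ _ _ hqr, mul_assoc]
    simp only [add_mul, mul_add, mul_assoc, h3, h4]

end IsCompression

end AlgebraicCompression

/-! ### The conditional expectation onto the tail algebra -/

section Expectation

open Filter Topology

attribute [local instance] isClosed_vonNeumann

variable {H : Type*} [NormedAddCommGroup H] [InnerProductSpace ℂ H] [CompleteSpace H]
  {A : VonNeumannAlgebra H} {K : Type*} [NormedAddCommGroup K] [InnerProductSpace ℂ K]
  [CompleteSpace K]
  {φ : A.toStarSubalgebra →ₗ[ℂ] ℂ} {π : A.toStarSubalgebra →⋆ₐ[ℂ] (K →L[ℂ] K)} {ξ : K}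
  {x : ℕ → A.toStarSubalgebra} {χ : A.toStarSubalgebra →ₐ[ℂ] ℂ}

/-- Subtracting `χ(a) 1` moves `a` into the non-unital closure, where the compression exists in the
tail algebra; the scalar is then put back. -/
theorem IsCyclicRep.exists_isCompression (h : IsCyclicRep φ π ξ) (hφ : IsNormalMap φ)
    (hφ' : IsNondegenerated φ) (hx : ∀ i, IsSelfAdjoint (x i))
    (hX : RunInvariant (fun i => π (x i)) ξ) (hχ : ∀ a, a ∈ wStar (Set.range x) ↔ χ a = 0) :
    ∃ E : A.toStarSubalgebra →ₗ[ℂ] unitalTail x,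
      IsCompression (π : A.toStarSubalgebra →ₐ[ℂ] (K →L[ℂ] K)) χ
        (tailProj (fun i => π (x i)) ξ) E := by
  set Q := tailProj (fun i => π (x i)) ξ with hQdef
  have hQ : Q * Q = Q := tailProj_mul_self _ _
  have hunit : (1 : A.toStarSubalgebra) ∉ wStar (Set.range x) := fun h1 => by
    simpa using (hχ 1).1 h1
  have hinj := h.injective hφ'
  have hscalar : ∀ (b : A.toStarSubalgebra) (c : ℂ),
      Q * π b * Q + c • 1 = Q * π (b + c • 1) * Q + c • (1 - Q) := by
    intro b c
    rw [map_add, map_smul, map_one, mul_add, add_mul, mul_smul_comm, smul_mul_assoc, mul_one, hQ,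
      smul_sub]
    abel
  have hex : ∀ a : A.toStarSubalgebra, ∃ e : unitalTail x,
      π e = Q * π a * Q + χ a • (1 - Q) := by
    intro a
    obtain ⟨e, he, he'⟩ := h.exists_compression hφ hφ' hx hX
      ((hχ (a - χ a • 1)).2 (by simp))
    refine ⟨⟨e + χ a • 1, (mem_unitalTail_iff_exists hunit _).2 ⟨e, he, χ a, rfl⟩⟩, ?_⟩
    rw [map_add, he', map_smul, map_one, hscalar, sub_add_cancel]
  choose E hE using hex
  refine ⟨{ toFun := E, map_add' := fun a b => ?_, map_smul' := fun c a => ?_ },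
    hinj, hQ, fun b => ?_, hE⟩
  · refine Subtype.ext (hinj ?_)
    rw [hE, Subalgebra.coe_add, map_add π (E a : A.toStarSubalgebra), hE, hE, map_add, map_add,
      mul_add, add_mul, add_smul]
    abel
  · refine Subtype.ext (hinj ?_)
    rw [hE, RingHom.id_apply, Subalgebra.coe_smul, map_smul π c (E a : A.toStarSubalgebra), hE,
      map_smul, map_smul, mul_smul_comm, smul_mul_assoc, smul_add, smul_smul, smul_eq_mul]
  · obtain ⟨t, ht, c, hb⟩ := (mem_unitalTail_iff_exists hunit _).1 b.2
    have hχt : χ t = 0 := (hχ t).1 (wStar_mono (Set.image_subset_range _ _)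
      (mem_nonunitalTail.1 ht 0))
    have hπt := h.tailProj_rep_tailProj hφ hx hX ht
    have hc : χ b = c := by rw [hb, map_add, hχt, map_smul, map_one]; simp
    change π (b : A.toStarSubalgebra) = Q * π b * Q + _
    rw [hc, hb, ← hscalar, hπt, map_add, map_smul, map_one]

variable {E : A.toStarSubalgebra →ₗ[ℂ] unitalTail x}

/-- The cyclic vector lies in the tail space, so `Q` fixes it and `1 - Q` kills it. -/
theorem IsCyclicRep.apply_expectation (h : IsCyclicRep φ π ξ)
    (hE : IsCompression (π : A.toStarSubalgebra →ₐ[ℂ] (K →L[ℂ] K)) χ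
      (tailProj (fun i => π (x i)) ξ) E) (a : A.toStarSubalgebra) :
    φ (E a : A.toStarSubalgebra) = φ a := by
  rw [h.apply_eq, h.apply_eq]
  have := hE.map_apply a
  change π _ = _ * π a * _ + _ at this
  rw [this, add_apply, mul_apply_eq_comp, mul_apply_eq_comp, smul_apply, sub_apply, tailProj_vec,
    one_apply_eq_self, sub_self, smul_zero, add_zero, ← inner_tailProj, tailProj_vec]

/-- Weak convergence in the representation space does not by itself give weak convergence on `H`.
Compactness first produces a limit `t` of the bounded values `E b` on `H`, and faithfulness of `π`
identifies it with `E a`. -/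
theorem IsCyclicRep.isNormalMap_expectation (h : IsCyclicRep φ π ξ) (hφ : IsNormalMap φ)
    (hφ' : IsNondegenerated φ) (hχ : ∀ a, a ∈ wStar (Set.range x) ↔ χ a = 0)
    (hE : IsCompression (π : A.toStarSubalgebra →ₐ[ℂ] (K →L[ℂ] K)) χ
      (tailProj (fun i => π (x i)) ξ) E) :
    IsNormalMap fun a => toWOT A (E a) := by
  set Q := tailProj (fun i => π (x i)) ξ with hQdef
  have hEa : ∀ a, π (E a) = Q * π a * Q + χ a • (1 - Q) := hE.map_apply
  refine isNormalMap_of_tendsto fun l a r hl ha => ?_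
  rw [tendsto_iff_ultrafilter]
  intro u hu
  have hur : ∀ᶠ b in (u : Filter A.toStarSubalgebra), ‖b‖ ≤ r := hu hl
  have hua := ha.mono hu
  have hbd : ∀ᶠ b in (u.map fun b => (E b : A.toStarSubalgebra) : Filter A.toStarSubalgebra),
      ‖b‖ ≤ r + r * ‖(1 : A.toStarSubalgebra)‖ * ‖1 - Q‖ := by
    rw [Ultrafilter.coe_map, eventually_map]
    filter_upwards [hur] with b hb
    rw [← h.norm_rep hφ', hEa]
    refine (norm_add_le _ _).trans (add_le_add ?_ ?_)
    · refine (norm_tailProj_mul_mul_le _ _ _).trans ?_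
      rwa [h.norm_rep hφ']
    · rw [norm_smul]
      gcongr
      exact (AlgHom.norm_apply_le_self_mul_norm_one χ b).trans (by gcongr)
  obtain ⟨t, ht⟩ := exists_wTendsto (u.map fun b => (E b : A.toStarSubalgebra)) hbd
  suffices hta : t = E a by
    rw [hta, wTendsto_iff, Ultrafilter.coe_map, tendsto_map'_iff] at ht
    exact ht
  refine h.injective hφ' (ContinuousLinearMap.ext fun ζ => ext_inner_left ℂ fun η => ?_)
  have h1 := h.tendsto_inner hφ hbd ht η ζ
  rw [Ultrafilter.coe_map, tendsto_map'_iff] at h1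
  refine tendsto_nhds_unique h1 ?_
  have h2 := (h.tendsto_inner_tailProj hφ hur hua (fun i => π (x i)) η ζ).add
    ((tendsto_character hχ hur hua).mul_const (inner ℂ η ((1 - Q) ζ)))
  simp only [← hQdef, ← inner_smul_right, ← smul_apply, ← inner_add_right, ← add_apply,
    ← hEa] at h2
  exact h2

end Expectation

end BooleanDeFinetti

end

open BooleanDeFinetti
theorem theorem7p3 {H : Type*} [NormedAddCommGroup H] [InnerProductSpace ℂ H] [CompleteSpace H]
    (A : VonNeumannAlgebra H) (φ : A.toStarSubalgebra →ₗ[ℂ] ℂ)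
    (hφ : IsNormalState φ) (hφ_nondeg : IsNondegenerated φ)
    (x : ℕ → A.toStarSubalgebra) (hx : ∀ i, IsSelfAdjoint (x i))
    (hgen : vN (Set.range x) = ⊤)
    (hunit : (1 : A.toStarSubalgebra) ∉ wStar (Set.range x)) :
    (∀ a : A.toStarSubalgebra,
      a ∈ unitalTail x ↔ ∃ t ∈ nonunitalTail x, ∃ c : ℂ, a = t + c • 1) ∧
    (SatisfiesBooleanInvariance φ x ↔
      ∃ E : A.toStarSubalgebra →ₗ[ℂ] unitalTail x,
        IsConditionalExpectation E ∧
        IsNormalMap (fun a => toWOT A (E a)) ∧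
        (∀ a, φ (E a : A.toStarSubalgebra) = φ a) ∧
        IdentDistribOver E x ∧
        BooleanIndepOver E x) := by
  refine ⟨mem_unitalTail_iff_exists hunit, fun hinv => ?_, ?_⟩
  · have hR := runEq_of_satisfiesBooleanInvariance φ x hinv
    obtain ⟨χ, hχ⟩ := exists_character hgen hunit
    obtain ⟨K, _, _, _, π, ξ, h⟩ := exists_isCyclicRep φ hφ.nonneg
    have hX := h.runInvariant hφ.normal hx hgen hR
    obtain ⟨E, hE⟩ := h.exists_isCompression hφ.normal hφ_nondeg hx hX hχ
    have hχx : ∀ i, χ (x i) = 0 := fun i =>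
      (hχ _).1 (subset_wStar _ (NonUnitalAlgebra.subset_adjoin ℂ ⟨i, rfl⟩))
    refine ⟨E, hE.isConditionalExpectation, h.isNormalMap_expectation hφ.normal hφ_nondeg hχ hE,
      h.apply_expectation hE, hE.identDistribOver hχx fun i j k => ?_,
      hE.booleanIndepOver hχx fun i j hij => hX.mul_tailProj_mul hij⟩
    -- A power is a constant word, which the transposition relabels from `i` to `j`.
    simpa using hX.tailProj_word_tailProj_map (Equiv.swap i j).injective (List.replicate k i)
  · rintro ⟨E, -, -, hφE, hid, hind⟩
    refine satisfiesBooleanInvariance_of_runEq φ x fun w w' hw => ?_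
    rw [← hφE (w.map x).prod, map_prod_eq_of_runEq E x hid hind w w' hw, hφE]
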